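/- Let $X$ be a measurable space, $Y\subseteq\mathbb{R}$, $\rho$ a probability measure on $X\times Y$, $V:\mathbb{R}\times\mathbb{R}\to\mathbb{R}_+$ a measurable loss function, and $\Phi:X\to\mathcal{F}$ a measurable map into a real separable Hilbert space. For $w\in\mathcal{F}$ put $\mathcal{E}(w)=\int V(y,\langle w,\Phi(x)\rangle)\,d\rho(x,y)$. Assume that (i) $\kappa=\sup_{x\in X}\|\Phi(x)\|<\infty$; for every $y\in Y$ the function $V(y,\cdot)$ is convex, with left-hand derivative $V'_-(y,\cdot)$ satisfying $|V'_-(y,a)|\le a_0$ for all $a\in\mathbb{R}$; and $|V|_0=\sup_{y\in Y}V(y,0)<\infty$; (ii) for some $\beta\in(0,1]$ and $c_\beta>0$, $\mathcal{D}(\lambda)=\inf_{w\in\mathcal{F}}\{\mathcal{E}(w)+\tfrac{\lambda}{2}\|w\|^2\}-\inf_{w\in\mathcal{F}}\mathcal{E}(w)\le c_\beta\lambda^\beta$ for all $\lambda>0$. Let $m\ge1$, let $\mathbf{z}=\{(x_i,y_i)\}_{i=1}^m$ be drawn i.i.d. from $\rho$, and let $j_1,j_2,\dots$ be i.i.d.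 uniform on $\{1,\dots,m\}$, independent of $\mathbf{z}$. The stochastic gradient method with constant step-size $\eta_t=m^{-\frac{2\beta}{2\beta+1}}$ ($t\ge 1$) is $w_1=0$, $w_{t+1}=w_t-\eta_tV'_-(y_{j_t},\langle w_t,\Phi(x_{j_t})\rangle)\Phi(x_{j_t})$, with weighted averages $\overline{w}_t=\sum_{k=1}^t\eta_kw_k\big/\sum_{k=1}^t\eta_k$. Then there is a constant $C>0$ depending only on $\kappa,a_0,|V|_0,c_\beta$ (not on $m$ or $t$, nor otherwise on the objects above) such that, for $g_t=\overline{w}_t$ and also for $g_t=w_t$, and for all integers $t\ge1$, $$\mathbb{E}_{\mathbf{z},J}\Big[\mathcal{E}(g_t)-\inf_{w\in\mathcal{F}}\mathcal{E}(w)\Big]\le C\Big(m^{-\frac{4\beta+1}{4\beta+2}}\sqrt{t}\,\log t+m^{-\frac{2\beta}{2\beta+1}}\log t+m^{\frac{2\beta^2}{2\beta+1}}t^{-\beta}\Big).$$ In particular, after one pass, $t^*=m$, if $m\ge2$, $$\mathbb{E}_{\mathbf{z},J}\Big[\mathcal{E}(g_m)-\inf_{w\in\mathcal{F}}\mathcal{E}(w)\Big]\le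 C\,m^{-\frac{\beta}{2\beta+1}}\log m.$$ -/

import Mathlib

open MeasureTheory ProbabilityTheory

universe u v

namespace SGM

noncomputable section

/-- The left-hand derivative of a univariate function `f` at `a`. -/
def leftDeriv (f : ℝ → ℝ) (a : ℝ) : ℝ := derivWithin f (Set.Iio a) a

section Learning

variable {X : Type u} [MeasurableSpace X] {Y : Set ℝ}
  {F : Type v} [NormedAddCommGroup F] [InnerProductSpace ℝ F]

/-- The expected risk `𝓔(w) = ∫ V(y, ⟨w, Φ(x)⟩) dρ(x, y)` of the function `x ↦ ⟨w, Φ(x)⟩`. -/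
def risk (ρ : Measure (X × Y)) (V : ℝ → ℝ → ℝ) (Φ : X → F) (w : F) : ℝ :=
  ∫ p, V (p.2 : ℝ) (inner ℝ w (Φ p.1)) ∂ρ

/-- The infimum of the expected risk over the whole space `F`. -/
def infRisk (ρ : Measure (X × Y)) (V : ℝ → ℝ → ℝ) (Φ : X → F) : ℝ :=
  ⨅ w : F, risk ρ V Φ w

/-- The approximation error
`𝓓(lam) = inf_w { 𝓔(w) + (lam / 2) ‖w‖² } - inf_w 𝓔(w)` of the triplet `(ρ, V, Φ)`. -/
def approxError (ρ : Measure (X × Y)) (V : ℝ → ℝ → ℝ) (Φ : X → F) (lam : ℝ) : ℝ :=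
  (⨅ w : F, (risk ρ V Φ w + lam / 2 * ‖w‖ ^ 2)) - infRisk ρ V Φ

/-- Boundedness assumption: `κ = sup_x ‖Φ(x)‖ < ∞`, the loss is convex in its second entry,
`V₀ = sup_{y ∈ Y} V(y, 0) < ∞`, and the left-hand derivative of the loss with respect to its second
entry is bounded by `a₀`. -/
structure BoundednessAssumption (Y : Set ℝ) (V : ℝ → ℝ → ℝ) (Φ : X → F) (κ a₀ V₀ : ℝ) : Prop where
  isLUB_feature : IsLUB (Set.range fun x => ‖Φ x‖) κ
  convex : ∀ y ∈ Y, ConvexOn ℝ Set.univ (V y)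
  isLUB_loss_zero : IsLUB ((fun y => V y 0) '' Y) V₀
  leftDeriv_bound : ∀ y ∈ Y, ∀ a : ℝ, |leftDeriv (V y) a| ≤ a₀

/-- Approximation error assumption: `𝓓(lam) ≤ c lam ^ β` for all `lam > 0`, where `β ∈ (0, 1]` and
`c > 0`. -/
structure ApproxErrorAssumption (ρ : Measure (X × Y)) (V : ℝ → ℝ → ℝ) (Φ : X → F)
    (β c : ℝ) : Prop where
  beta_pos : 0 < β
  beta_le_one : β ≤ 1
  c_pos : 0 < c
  decay : ∀ lam : ℝ, 0 < lam → approxError ρ V Φ lam ≤ c * lam ^ β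

/-- The iterates of the stochastic gradient method with step-sizes `η`, on the sample `z`, when
the index drawn at step `t = 1, 2, …` is `j t`: `w₁ = 0` and
`w_{t+1} = w_t - η_t V'₋(y_{j_t}, ⟨w_t, Φ(x_{j_t})⟩) Φ(x_{j_t})`.
The iterates are numbered from `1`; the value at `0` and the index `j 0` play no role. -/
def iterate (V : ℝ → ℝ → ℝ) (Φ : X → F) (η : ℕ → ℝ) {m : ℕ} (z : Fin m → X × Y)
    (j : ℕ → Fin m) : ℕ → F
  | 0 => 0
  | 1 => 0
  | t + 2 =>
    let w := iterate V Φ η z j (t + 1)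
    let x := (z (j (t + 1))).1
    let y : ℝ := (z (j (t + 1))).2
    w - (η (t + 1) * leftDeriv (V y) (inner ℝ w (Φ x))) • Φ x

/-- The weighted averages `(∑_{k=1}^t η_k w_k) / (∑_{k=1}^t η_k)` of the iterates. -/
def average (V : ℝ → ℝ → ℝ) (Φ : X → F) (η : ℕ → ℝ) {m : ℕ} (z : Fin m → X × Y)
    (j : ℕ → Fin m) (t : ℕ) : F :=
  (∑ k ∈ Finset.Icc 1 t, η k)⁻¹ • ∑ k ∈ Finset.Icc 1 t, η k • iterate V Φ η z j k

/-- The joint law of the sample `z` (`m` points drawn independently from `ρ`) and of the indices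
`j₁, j₂, …` (drawn independently of each other and of `z`, uniformly from the `m` indices).
The expectation with respect to `z` and `J` is the integral against this measure. -/
def sampleLaw (ρ : Measure (X × Y)) (m : ℕ) : Measure ((Fin m → X × Y) × (ℕ → Fin m)) :=
  (Measure.pi fun _ : Fin m => ρ).prod
    (Measure.infinitePi fun _ : ℕ => uniformOn (Set.univ : Set (Fin m)))

/-- The excess risk `𝓔(g(z, J)) - inf_w 𝓔(w)` of an output `g` of the method, as a random variable
of the sample `z` and of the drawn indices `J`. -/
def excessRisk (ρ : Measure (X × Y)) (V : ℝ → ℝ → ℝ) (Φ : X → F) {m : ℕ}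
    (g : (Fin m → X × Y) → (ℕ → Fin m) → F) (s : (Fin m → X × Y) × (ℕ → Fin m)) : ℝ :=
  risk ρ V Φ (g s.1 s.2) - infRisk ρ V Φ

end Learning

end

end SGM

set_option linter.unusedSectionVars false

/-! Write `e` for the step size, `G = a₀ * κ`, and compare the risk of the output with `infRisk`
through the empirical risk. Three errors add up.

Optimization. The left derivative is a subgradient, so a step towards any `u` decreases `‖w - u‖ ^
2` by `2 * e` times the gap in loss at the drawn example, up to `e ^ 2 * G ^ 2`. The index `j_k` is
uniform and independent of `w_k`, so in expectation that gap is one of empirical risks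
(`two_mul_integral_empRisk_sub_le`). Telescoping from `w_1 = 0` against a fixed `w` bounds the
average of the expected empirical risks by `risk w + ‖w‖ ^ 2 / (2 * e * t) + e * G ^ 2 / 2`.
Telescoping from `w_k` against `w_k` itself carries this to the last iterate at the price of a
factor `log t` (`last_le_average_add_log`).

Approximation. The infimum over `w` of that bound is the regularized risk with parameter `1 / (e *
t)`, whence the approximation error at that parameter.

Generalization. Comparison with `u = 0` confines all iterates up to time `t` to a deterministic ball
of radius `R` of order `√(e * t)`. Symmetrization, contraction and orthogonality of random signs in
an inner product space bound the uniform deviation over that ball by `2 * G * R / √m`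
(`exists_uniform_deviation`).

With `e = m ^ (-(2 * β / (2 * β + 1)))` these errors have the orders of the three terms claimed; at
`t = m` each is at most of order `m ^ (-(β / (2 * β + 1)))`, up to `log m`. -/

namespace SGM

open Filter Topology

/-! ### Left derivatives of convex functions -/

section Convex

/-- The left derivative is a subgradient: it dominates the slopes to the left, and is at most the
right derivative, hence at most the slopes to the right. -/
theorem add_leftDeriv_mul_sub_le {f : ℝ → ℝ} (hf : ConvexOn ℝ Set.univ f) (a b : ℝ) :
    f a + leftDeriv f a * (b - a) ≤ f b := by
  have ha : a ∈ interior (Set.univ : Set ℝ) := by simp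
  have hd := hf.hasDerivWithinAt_leftDeriv_of_mem_interior ha
  rcases lt_trichotomy b a with h | rfl | h
  · have h1 := hf.slope_le_of_hasDerivWithinAt_Iio trivial trivial h hd
    rw [slope_def_field, div_le_iff₀ (by linarith)] at h1
    simp only [leftDeriv]
    linarith
  · simp
  · have h1 := (hf.leftDeriv_le_rightDeriv_of_mem_interior ha).trans
      (hf.rightDeriv_le_slope_of_mem_interior ha trivial h)
    rw [slope_def_field, le_div_iff₀ (by linarith)] at h1
    simp only [leftDeriv]
    linarith

theorem abs_sub_le_of_leftDeriv_bound {f : ℝ → ℝ} (hf : ConvexOn ℝ Set.univ f) {L : ℝ}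
    (hL : ∀ a, |leftDeriv f a| ≤ L) (a b : ℝ) : |f a - f b| ≤ L * |a - b| := by
  have key : ∀ a b, f a - f b ≤ L * |a - b| := fun a b => by
    have h1 := add_leftDeriv_mul_sub_le hf a b
    have h2 : leftDeriv f a * (a - b) ≤ L * |a - b| :=
      (le_abs_self _).trans (by rw [abs_mul]; gcongr; exact hL a)
    linarith
  rw [abs_le]
  constructor
  · have := key b a
    rw [abs_sub_comm] at this
    linarith
  · exact key a b

/-- A limit along a sequence of backward quotients, so that measurability of the loss passes to its
left derivative. -/
theorem tendsto_leftDeriv {f : ℝ → ℝ} (hf : ConvexOn ℝ Set.univ f) (a : ℝ) :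
    Tendsto (fun n : ℕ => ((n : ℝ) + 1) * (f a - f (a - 1 / ((n : ℝ) + 1)))) atTop
      (𝓝 (leftDeriv f a)) := by
  have hd := hf.hasDerivWithinAt_leftDeriv_of_mem_interior (x := a) (by simp)
  have h1 := (hasDerivWithinAt_iff_tendsto_slope' Set.self_notMem_Iio).mp hd
  have h2 : Tendsto (fun n : ℕ => a - 1 / ((n : ℝ) + 1)) atTop (𝓝[<] a) := by
    refine tendsto_nhdsWithin_iff.2 ⟨?_, Eventually.of_forall fun n => ?_⟩
    · simpa using (tendsto_const_nhds (x := a)).sub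
        (tendsto_one_div_add_atTop_nhds_zero_nat (𝕜 := ℝ))
    · have : 0 < 1 / ((n : ℝ) + 1) := by positivity
      simpa using this
  refine (h1.comp h2).congr fun n => ?_
  have : (n : ℝ) + 1 ≠ 0 := by positivity
  simp only [Function.comp, slope_def_field]
  field_simp
  ring

theorem measurable_leftDeriv {α : Type*} [MeasurableSpace α] {V : ℝ → ℝ → ℝ}
    (hV : Measurable (Function.uncurry V)) {y a : α → ℝ} (hy : Measurable y) (ha : Measurable a)
    (hc : ∀ p, ConvexOn ℝ Set.univ (V (y p))) :
    Measurable fun p => leftDeriv (V (y p)) (a p) := by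
  refine measurable_of_tendsto_metrizable
    (f := fun (n : ℕ) p => ((n : ℝ) + 1) * (V (y p) (a p) - V (y p) (a p - 1 / ((n : ℝ) + 1))))
    (fun n => ?_) (tendsto_pi_nhds.2 fun p => tendsto_leftDeriv (hc p) (a p))
  have h1 : Measurable fun p => V (y p) (a p) := hV.comp (hy.prodMk ha)
  have h2 : Measurable fun p => V (y p) (a p - 1 / ((n : ℝ) + 1)) :=
    hV.comp (hy.prodMk (ha.sub_const _))
  exact (h1.sub h2).const_mul _

end Convex

/-! ### Rademacher sums: contraction and second moments -/

section Signs

/-- The sign attached to a Boolean. -/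
def sgn (b : Bool) : ℝ := if b then 1 else -1

@[simp] theorem sgn_true : sgn true = 1 := rfl

@[simp] theorem sgn_false : sgn false = -1 := rfl

theorem abs_sgn (b : Bool) : |sgn b| = 1 := by cases b <;> simp

theorem sum_bool_cons {n : ℕ} (g : (Fin (n + 1) → Bool) → ℝ) :
    ∑ σ, g σ = ∑ σ : Fin n → Bool, g (Fin.cons true σ) + ∑ σ : Fin n → Bool, g (Fin.cons false σ) := by
  rw [← (Fin.consEquiv fun _ : Fin (n + 1) => Bool).sum_comp, Fintype.sum_prod_type]
  simp [Fin.consEquiv]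

theorem abs_ciSup_le {ι : Type*} [Nonempty ι] {h : ι → ℝ} {B : ℝ} (hB : ∀ i, |h i| ≤ B) :
    |⨆ i, h i| ≤ B := by
  have i := Classical.arbitrary ι
  have hb : BddAbove (Set.range h) := ⟨B, by rintro _ ⟨i, rfl⟩; exact (abs_le.1 (hB i)).2⟩
  exact abs_le.2 ⟨(abs_le.1 (hB i)).1.trans (le_ciSup hb i), ciSup_le fun i => (abs_le.1 (hB i)).2⟩

theorem bddAbove_of_abs {ι : Type*} {h : ι → ℝ} {B : ℝ} (hB : ∀ i, |h i| ≤ B) :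
    BddAbove (Set.range h) := ⟨B, by rintro _ ⟨i, rfl⟩; exact (abs_le.1 (hB i)).2⟩

/-- Contraction for a single sign. For a pair `i`, `j` on the left, bound `a i - a j` by `|b i - b
j|`, then assign `i` and `j` to the two suprema on the right in the order given by the sign of `b i
- b j`. -/
theorem ciSup_add_sub_le {ι : Type*} [Nonempty ι] {u a b : ι → ℝ} {Bu Bb : ℝ}
    (hu : ∀ i, |u i| ≤ Bu) (hb : ∀ i, |b i| ≤ Bb)
    (hab : ∀ i j, a i - a j ≤ |b i - b j|) :
    (⨆ i, (u i + a i)) + ⨆ i, (u i - a i) ≤ (⨆ i, (u i + b i)) + ⨆ i, (u i - b i) := by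
  have h1 : BddAbove (Set.range fun i => u i + b i) :=
    bddAbove_of_abs fun i => (abs_add_le _ _).trans (add_le_add (hu i) (hb i))
  have h2 : BddAbove (Set.range fun i => u i - b i) :=
    bddAbove_of_abs fun i => (abs_sub _ _).trans (add_le_add (hu i) (hb i))
  rw [← le_sub_iff_add_le]
  refine ciSup_le fun i => ?_
  rw [le_sub_iff_add_le, ← le_sub_iff_add_le']
  refine ciSup_le fun j => ?_
  have e := hab i j
  have i1 := le_ciSup h1 i
  have i2 := le_ciSup h1 j
  have i3 := le_ciSup h2 i
  have i4 := le_ciSup h2 j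
  rcases abs_cases (b i - b j) with h | h <;> linarith

theorem abs_sum_sgn_mul_le {n : ℕ} (σ : Fin n → Bool) {b : Fin n → ℝ} {B : ℝ}
    (hb : ∀ k, |b k| ≤ B) : |∑ k, sgn (σ k) * b k| ≤ n * B := by
  refine (Finset.abs_sum_le_sum_abs _ _).trans ?_
  refine (Finset.sum_le_sum fun k _ => (?_ : _ ≤ B)).trans (by simp)
  rw [abs_mul, abs_sgn, one_mul]
  exact hb k

/-- The contraction principle for Rademacher averages, without absolute values. -/
theorem sum_signs_ciSup_le {ι : Type*} [Nonempty ι] {B : ℝ} :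
    ∀ (n : ℕ) (Bu : ℝ) (u : ι → ℝ) (a b : Fin n → ι → ℝ), (∀ i, |u i| ≤ Bu) →
      (∀ k i, |a k i| ≤ B) → (∀ k i, |b k i| ≤ B) → (∀ k i j, a k i - a k j ≤ |b k i - b k j|) →
      ∑ σ : Fin n → Bool, ⨆ i, (u i + ∑ k, sgn (σ k) * a k i) ≤
        ∑ σ : Fin n → Bool, ⨆ i, (u i + ∑ k, sgn (σ k) * b k i) := by
  intro n
  induction n with
  | zero => intro Bu u a b _ _ _ _; simp
  | succ n ih =>
    intro Bu u a b hu ha hb hab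
    -- Split on the first sign. The offset `u` absorbs the first coordinate while induction
    -- contracts the others; the first is then contracted for each pattern of the remaining signs.
    rw [sum_bool_cons, sum_bool_cons]
    simp only [Fin.sum_univ_succ, Fin.cons_zero, Fin.cons_succ, sgn_true, sgn_false, one_mul,
      neg_mul, ← add_assoc]
    have i1 := ih (Bu + B) (fun i => u i + a 0 i) (fun k => a k.succ) (fun k => b k.succ)
      (fun i => (abs_add_le _ _).trans (add_le_add (hu i) (ha 0 i))) (fun k => ha k.succ)
      (fun k => hb k.succ) (fun k => hab k.succ)
    have i2 := ih (Bu + B) (fun i => u i + -a 0 i) (fun k => a k.succ) (fun k => b k.succ)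
      (fun i => (abs_add_le _ _).trans (add_le_add (hu i) (by rw [abs_neg]; exact ha 0 i)))
      (fun k => ha k.succ) (fun k => hb k.succ) (fun k => hab k.succ)
    refine (add_le_add i1 i2).trans ?_
    rw [← Finset.sum_add_distrib, ← Finset.sum_add_distrib]
    refine Finset.sum_le_sum fun σ _ => ?_
    have := ciSup_add_sub_le (u := fun i => u i + ∑ k, sgn (σ k) * b k.succ i) (a := a 0)
      (b := b 0) (Bu := Bu + n * B) (Bb := B)
      (fun i => (abs_add_le _ _).trans (add_le_add (hu i)
        (abs_sum_sgn_mul_le σ fun k => hb k.succ i))) (hb 0) (hab 0)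
    have e1 : ∀ i, u i + b 0 i + ∑ k, sgn (σ k) * b k.succ i =
        u i + ∑ k, sgn (σ k) * b k.succ i + b 0 i := fun i => by ring
    have e2 : ∀ i, u i + -b 0 i + ∑ k, sgn (σ k) * b k.succ i =
        u i + ∑ k, sgn (σ k) * b k.succ i - b 0 i := fun i => by ring
    have e3 : ∀ i, u i + a 0 i + ∑ k, sgn (σ k) * b k.succ i =
        u i + ∑ k, sgn (σ k) * b k.succ i + a 0 i := fun i => by ring
    have e4 : ∀ i, u i + -a 0 i + ∑ k, sgn (σ k) * b k.succ i =
        u i + ∑ k, sgn (σ k) * b k.succ i - a 0 i := fun i => by ring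
    simpa only [e1, e2, e3, e4] using this

variable {F : Type*} [NormedAddCommGroup F] [InnerProductSpace ℝ F]

/-- Cross terms cancel over the signs; by induction this is the parallelogram law applied to `u ± x
0`. -/
theorem sum_signs_norm_sq : ∀ (n : ℕ) (u : F) (x : Fin n → F),
    ∑ σ : Fin n → Bool, ‖u + ∑ k, sgn (σ k) • x k‖ ^ 2 = 2 ^ n * (‖u‖ ^ 2 + ∑ k, ‖x k‖ ^ 2) := by
  intro n
  induction n with
  | zero => intro u x; simp
  | succ n ih =>
    intro u x
    rw [sum_bool_cons]
    simp only [Fin.sum_univ_succ, Fin.cons_zero, Fin.cons_succ, sgn_true, sgn_false, one_smul,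
      neg_smul, ← add_assoc]
    rw [ih (u + x 0), ih (u + -x 0), ← sub_eq_add_neg]
    have := parallelogram_law_with_norm ℝ u (x 0)
    rw [pow_succ]
    linear_combination (2 ^ n : ℝ) * this

/-- Cauchy–Schwarz over the `2 ^ n` sign patterns reduces the first moment to the second. -/
theorem sum_signs_norm_le {n : ℕ} {κ : ℝ} (hκ : 0 ≤ κ) (x : Fin n → F) (hx : ∀ k, ‖x k‖ ≤ κ) :
    ∑ σ : Fin n → Bool, ‖∑ k, sgn (σ k) • x k‖ ≤ 2 ^ n * (Real.sqrt n * κ) := by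
  have h1 := sq_sum_le_card_mul_sum_sq (s := (Finset.univ : Finset (Fin n → Bool)))
    (f := fun σ => ‖∑ k, sgn (σ k) • x k‖)
  have h2 := sum_signs_norm_sq n 0 x
  simp only [zero_add, norm_zero] at h2
  rw [h2] at h1
  have h3 : ∑ k, ‖x k‖ ^ 2 ≤ n * κ ^ 2 := by
    refine (Finset.sum_le_sum fun k _ => (?_ : _ ≤ κ ^ 2)).trans (by simp)
    gcongr
    exact hx k
  refine abs_le_of_sq_le_sq' ?_ (by positivity) |>.2
  refine h1.trans ?_
  rw [mul_pow, mul_pow, Real.sq_sqrt (by positivity)]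
  simp only [Finset.card_univ, Fintype.card_pi, Fintype.card_bool, Finset.prod_const,
    Fintype.card_fin, Nat.cast_pow, Nat.cast_ofNat]
  rw [pow_two ((2 : ℝ) ^ n), mul_assoc]
  gcongr
  linarith

end Signs

/-! ### Symmetrization with a ghost sample -/

section Symmetrization

variable {Z : Type*} [MeasurableSpace Z]

theorem integrable_ciSup {Ω ι : Type*} [MeasurableSpace Ω] [Countable ι] [Nonempty ι]
    {μ : Measure Ω} [IsFiniteMeasure μ] {h : ι → Ω → ℝ} (hm : ∀ i, Measurable (h i)) {B : ℝ}
    (hB : ∀ i ω, |h i ω| ≤ B) : Integrable (fun ω => ⨆ i, h i ω) μ :=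
  Integrable.of_bound (Measurable.iSup hm).aestronglyMeasurable B
    (Eventually.of_forall fun ω => abs_ciSup_le fun i => hB i ω)

/-- Symmetrization: a one-sided uniform deviation is controlled by the Rademacher average. -/
theorem two_pow_mul_integral_ciSup_le (ρ : Measure Z) [IsProbabilityMeasure ρ] {ι : Type*}
    [Countable ι] [Nonempty ι] {f : ι → Z → ℝ} (hf : ∀ i, Measurable (f i)) {B : ℝ}
    (hB : ∀ i z, |f i z| ≤ B) (m : ℕ) :
    2 ^ m * ∫ z, ⨆ i, ∑ k : Fin m, ((∫ x, f i x ∂ρ) - f i (z k)) ∂(Measure.pi fun _ => ρ) ≤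
      2 * ∑ σ : Fin m → Bool,
        ∫ z, ⨆ i, ∑ k, sgn (σ k) * f i (z k) ∂(Measure.pi fun _ => ρ) := by
  set P : Measure (Fin m → Z) := Measure.pi fun _ => ρ with hP
  set Q : Measure (Fin m → Z × Z) := Measure.pi fun _ => ρ.prod ρ with hQ
  have hE : ∀ i, |∫ x, f i x ∂ρ| ≤ B := fun i => by
    simpa using norm_integral_le_of_norm_le_const (μ := ρ) (f := f i)
      (Eventually.of_forall fun z => hB i z)
  have habs : ∀ (a b : Fin m → ℝ), (∀ k, |a k| ≤ B) → (∀ k, |b k| ≤ B) →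
      |∑ k, (a k - b k)| ≤ m * (B + B) := fun a b ha hb => by
    refine (Finset.abs_sum_le_sum_abs _ _).trans ?_
    refine (Finset.sum_le_sum fun k _ => (?_ : _ ≤ B + B)).trans (by simp [mul_add])
    exact (abs_sub _ _).trans (add_le_add (ha k) (hb k))
  -- Uniform deviation between the sample and an independent ghost copy, stored as pairs so that
  -- each pair can be swapped separately.
  set D : (Fin m → Z × Z) → ℝ := fun p => ⨆ i, ∑ k, (f i (p k).1 - f i (p k).2) with hD
  have hDm : Measurable D := by
    refine Measurable.iSup fun i => Finset.measurable_sum _ fun k _ => ?_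
    exact ((hf i).comp (measurable_fst.comp (measurable_pi_apply k))).sub
      ((hf i).comp (measurable_snd.comp (measurable_pi_apply k)))
  -- The mean is the expectation over the ghost sample, and a supremum of expectations is at most
  -- the expectation of the supremum.
  have step1 : ∫ z, ⨆ i, ∑ k : Fin m, ((∫ x, f i x ∂ρ) - f i (z k)) ∂P ≤ ∫ p, D p ∂Q := by
    set D' : (Fin m → Z) × (Fin m → Z) → ℝ := fun q => ⨆ i, ∑ k, (f i (q.1 k) - f i (q.2 k))
      with hD'
    have hm' : ∀ i, Measurable fun q : (Fin m → Z) × (Fin m → Z) =>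
        ∑ k, (f i (q.1 k) - f i (q.2 k)) := fun i => by
      refine Finset.measurable_sum _ fun k _ => ?_
      exact ((hf i).comp ((measurable_pi_apply k).comp measurable_fst)).sub
        ((hf i).comp ((measurable_pi_apply k).comp measurable_snd))
    have hI : Integrable D' (P.prod P) :=
      integrable_ciSup hm' (fun i q => habs _ _ (fun k => hB i _) fun k => hB i _)
    have e : ∫ p, D p ∂Q = ∫ q, D' q ∂(P.prod P) :=
      (measurePreserving_arrowProdEquivProdArrow Z Z (Fin m) (fun _ => ρ)
        (fun _ => ρ)).integral_comp' D'
    rw [e, integral_prod_symm _ hI]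
    refine integral_mono ?_ hI.integral_prod_right fun z => ?_
    · refine integrable_ciSup (B := m * (B + B)) (fun i => ?_)
        fun i z => habs _ _ (fun k => hE i) fun k => hB i _
      exact Finset.measurable_sum _ fun k _ => measurable_const.sub
        ((hf i).comp (measurable_pi_apply k))
    · refine ciSup_le fun i => ?_
      have hi : ∀ k : Fin m, Integrable (fun z' : Fin m → Z => f i (z' k)) P := fun k =>
        Integrable.of_bound ((hf i).comp (measurable_pi_apply k)).aestronglyMeasurable B
          (Eventually.of_forall fun z => hB i _)
      have e2 : ∑ k : Fin m, ((∫ x, f i x ∂ρ) - f i (z k)) =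
          ∫ z', ∑ k, (f i (z' k) - f i (z k)) ∂P := by
        have hik : ∀ k : Fin m, Integrable (fun z' : Fin m → Z => f i (z' k) - f i (z k)) P :=
          fun k => (hi k).sub (integrable_const _)
        rw [integral_finsetSum _ fun k _ => hik k]
        refine Finset.sum_congr rfl fun k _ => ?_
        rw [integral_sub (hi k) (integrable_const _), integral_const]
        simp only [probReal_univ, one_smul]
        congr 1
        have := (measurePreserving_eval (fun _ : Fin m => ρ) k)
        rw [← this.map_eq, integral_map this.measurable.aemeasurable
          (hf i).aestronglyMeasurable]
      rw [e2]
      refine integral_mono (integrable_finsetSum _ fun k _ => (hi k).sub (integrable_const _))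
        ?_ fun z' => ?_
      · exact integrable_ciSup (fun i => (hm' i).comp (measurable_id.prodMk measurable_const))
          (fun i q => habs _ _ (fun k => hB i _) fun k => hB i _)
      · exact le_ciSup (f := fun i => ∑ k, (f i (z' k) - f i (z k)))
          (bddAbove_of_abs fun i => habs _ _ (fun k => hB i _) fun k => hB i _) i
  have hR : ∀ σ : Fin m → Bool, Measurable fun z : Fin m → Z =>
      ⨆ i, ∑ k, sgn (σ k) * f i (z k) := fun σ =>
    Measurable.iSup fun i => Finset.measurable_sum _ fun k _ =>
      ((hf i).comp (measurable_pi_apply k)).const_mul _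
  have hRi : ∀ σ : Fin m → Bool, Integrable (fun z : Fin m → Z =>
      ⨆ i, ∑ k, sgn (σ k) * f i (z k)) P := fun σ =>
    integrable_ciSup (fun i => Finset.measurable_sum _ fun k _ =>
      ((hf i).comp (measurable_pi_apply k)).const_mul _)
      fun i z => abs_sum_sgn_mul_le σ fun k => hB i (z k)
  have p1 : MeasurePreserving (fun (p : Fin m → Z × Z) k => (p k).1) Q P :=
    measurePreserving_pi _ _ fun _ => measurePreserving_fst
  have p2 : MeasurePreserving (fun (p : Fin m → Z × Z) k => (p k).2) Q P :=
    measurePreserving_pi _ _ fun _ => measurePreserving_snd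
  -- Swapping the pairs where `σ k` is false preserves the law and puts the sign `sgn (σ k)` on the
  -- `k`-th difference. The supremum then splits into one for each half of the pairs.
  have step2 : ∀ σ : Fin m → Bool, ∫ p, D p ∂Q ≤
      (∫ z, ⨆ i, ∑ k, sgn (σ k) * f i (z k) ∂P) +
        ∫ z, ⨆ i, ∑ k, sgn (!σ k) * f i (z k) ∂P := fun σ => by
    have hT : MeasurePreserving
        (fun (p : Fin m → Z × Z) k => (if σ k then id else Prod.swap) (p k)) Q Q := by
      refine measurePreserving_pi _ _ fun k => ?_
      cases σ k
      · simpa using Measure.measurePreserving_swap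
      · simpa using MeasurePreserving.id _
    conv_lhs => rw [← hT.map_eq, integral_map hT.measurable.aemeasurable
      hDm.aestronglyMeasurable]
    have e1 := integral_map (μ := Q) p1.measurable.aemeasurable
      (hR σ).aestronglyMeasurable
    have e2 := integral_map (μ := Q) p2.measurable.aemeasurable
      (hR fun k => !σ k).aestronglyMeasurable
    rw [p1.map_eq] at e1
    rw [p2.map_eq] at e2
    rw [e1, e2]
    have j1 : Integrable (fun p : Fin m → Z × Z => ⨆ i, ∑ k, sgn (σ k) * f i (p k).1) Q :=
      p1.integrable_comp_of_integrable (hRi σ)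
    have j2 : Integrable (fun p : Fin m → Z × Z => ⨆ i, ∑ k, sgn (!σ k) * f i (p k).2) Q :=
      p2.integrable_comp_of_integrable (hRi fun k => !σ k)
    rw [← integral_add j1 j2]
    have hDi : Integrable D Q := integrable_ciSup (fun i => Finset.measurable_sum _ fun k _ =>
      ((hf i).comp (measurable_fst.comp (measurable_pi_apply k))).sub
        ((hf i).comp (measurable_snd.comp (measurable_pi_apply k))))
      (fun i q => habs _ _ (fun k => hB i _) fun k => hB i _)
    refine integral_mono (hT.integrable_comp_of_integrable hDi) (j1.add j2) fun p => ?_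
    refine ciSup_le fun i => ?_
    have b1 := le_ciSup (bddAbove_of_abs fun i => abs_sum_sgn_mul_le σ fun k => hB i (p k).1) i
    have b2 := le_ciSup (bddAbove_of_abs fun i =>
      abs_sum_sgn_mul_le (fun k => !σ k) fun k => hB i (p k).2) i
    refine le_trans (le_of_eq ?_) (add_le_add b1 b2)
    rw [← Finset.sum_add_distrib]
    refine Finset.sum_congr rfl fun k _ => ?_
    cases h : σ k <;> simp [h] <;> ring
  -- Flipping all signs permutes the patterns, so both halves contribute equally: this is the factor
  -- `2`.
  have hsum : ∑ σ : Fin m → Bool, ∫ z, ⨆ i, ∑ k, sgn (!σ k) * f i (z k) ∂P =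
      ∑ σ : Fin m → Bool, ∫ z, ⨆ i, ∑ k, sgn (σ k) * f i (z k) ∂P :=
    (Equiv.piCongrRight fun _ : Fin m => Equiv.boolNot).sum_comp
      (fun σ : Fin m → Bool => ∫ z, ⨆ i, ∑ k, sgn (σ k) * f i (z k) ∂P)
  have h3 := Finset.sum_le_sum fun (σ : Fin m → Bool) (_ : σ ∈ Finset.univ) => step2 σ
  rw [Finset.sum_add_distrib, hsum] at h3
  simp only [Finset.sum_const, Finset.card_univ, Fintype.card_pi, Fintype.card_bool,
    Finset.prod_const, Fintype.card_fin, nsmul_eq_mul, Nat.cast_pow, Nat.cast_ofNat] at h3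
  have : (2 : ℝ) ^ m * ∫ z, ⨆ i, ∑ k : Fin m, ((∫ x, f i x ∂ρ) - f i (z k)) ∂P ≤
      2 ^ m * ∫ p, D p ∂Q := by gcongr
  linarith

end Symmetrization

/-! ### Regularity of the risks and uniform deviation over a ball -/

section Setting

variable {X : Type u} [MeasurableSpace X] {Y : Set ℝ}
  {F : Type v} [NormedAddCommGroup F] [InnerProductSpace ℝ F]

/-- The loss of the function `x ↦ ⟨w, Φ(x)⟩` at an example. -/
noncomputable def loss (V : ℝ → ℝ → ℝ) (Φ : X → F) (w : F) (p : X × Y) : ℝ :=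
  V (p.2 : ℝ) (inner ℝ w (Φ p.1))

/-- The empirical risk on a sample. -/
noncomputable def empRisk (V : ℝ → ℝ → ℝ) (Φ : X → F) {m : ℕ} (z : Fin m → X × Y) (w : F) : ℝ :=
  (m : ℝ)⁻¹ * ∑ k, loss V Φ w (z k)

/-- The boundedness assumption together with measurability and nonnegativity of the loss. -/
structure LearningSetting [MeasurableSpace F] (Y : Set ℝ) (V : ℝ → ℝ → ℝ) (Φ : X → F)
    (κ a₀ V₀ : ℝ) : Prop extends BoundednessAssumption Y V Φ κ a₀ V₀ where
  measurable_loss : Measurable (Function.uncurry V)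
  loss_nonneg : ∀ y a : ℝ, 0 ≤ V y a
  measurable_feature : Measurable Φ

namespace LearningSetting

variable [MeasurableSpace F] {V : ℝ → ℝ → ℝ} {Φ : X → F} {κ a₀ V₀ : ℝ}

theorem norm_feature_le (h : LearningSetting Y V Φ κ a₀ V₀) (x : X) : ‖Φ x‖ ≤ κ :=
  h.isLUB_feature.1 ⟨x, rfl⟩

theorem feature_bound_nonneg (h : LearningSetting Y V Φ κ a₀ V₀) (p : X × Y) : 0 ≤ κ :=
  (norm_nonneg _).trans (h.norm_feature_le p.1)

theorem slope_bound_nonneg (h : LearningSetting Y V Φ κ a₀ V₀) (p : X × Y) : 0 ≤ a₀ :=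
  (abs_nonneg _).trans (h.leftDeriv_bound p.2 p.2.2 0)

theorem loss_zero_le (h : LearningSetting Y V Φ κ a₀ V₀) (p : X × Y) : V p.2 0 ≤ V₀ :=
  h.isLUB_loss_zero.1 ⟨p.2, p.2.2, rfl⟩

theorem loss_zero_bound_nonneg (h : LearningSetting Y V Φ κ a₀ V₀) (p : X × Y) : 0 ≤ V₀ :=
  (h.loss_nonneg _ _).trans (h.loss_zero_le p)

theorem abs_loss_sub_le (h : LearningSetting Y V Φ κ a₀ V₀) (w w' : F) (p : X × Y) :
    |loss V Φ w p - loss V Φ w' p| ≤ a₀ * κ * ‖w - w'‖ := by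
  have ha := h.slope_bound_nonneg p
  refine (abs_sub_le_of_leftDeriv_bound (h.convex p.2 p.2.2) (h.leftDeriv_bound p.2 p.2.2)
    _ _).trans ?_
  rw [← inner_sub_left, mul_assoc]
  gcongr
  refine (abs_real_inner_le_norm _ _).trans ?_
  rw [mul_comm]
  gcongr
  exact h.norm_feature_le _

theorem loss_nonneg' (h : LearningSetting Y V Φ κ a₀ V₀) (w : F) (p : X × Y) :
    0 ≤ loss V Φ w p := h.loss_nonneg _ _

theorem abs_loss_le (h : LearningSetting Y V Φ κ a₀ V₀) {w : F} {R : ℝ} (hw : ‖w‖ ≤ R)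
    (p : X × Y) : |loss V Φ w p| ≤ V₀ + a₀ * κ * R := by
  rw [abs_of_nonneg (h.loss_nonneg' w p)]
  have h1 := (abs_le.1 (h.abs_loss_sub_le w 0 p)).2
  have h2 : loss V Φ 0 p ≤ V₀ := by simpa [loss] using h.loss_zero_le p
  have ha := h.slope_bound_nonneg p
  have hk := h.feature_bound_nonneg p
  rw [sub_zero] at h1
  have : a₀ * κ * ‖w‖ ≤ a₀ * κ * R := by gcongr
  linarith

theorem loss_add_le (h : LearningSetting Y V Φ κ a₀ V₀) (w u : F) (p : X × Y) :
    loss V Φ w p + leftDeriv (V p.2) (inner ℝ w (Φ p.1)) * (inner ℝ u (Φ p.1) - inner ℝ w (Φ p.1))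
      ≤ loss V Φ u p :=
  add_leftDeriv_mul_sub_le (h.convex p.2 p.2.2) _ _

theorem convexOn_loss (h : LearningSetting Y V Φ κ a₀ V₀) (p : X × Y) :
    ConvexOn ℝ Set.univ fun w => loss V Φ w p := by
  refine ⟨convex_univ, fun w _ w' _ a b ha hb hab => ?_⟩
  have := (h.convex p.2 p.2.2).2 (Set.mem_univ (inner ℝ w (Φ p.1)))
    (Set.mem_univ (inner ℝ w' (Φ p.1))) ha hb hab
  simpa [loss, inner_add_left, inner_smul_left] using this

variable [BorelSpace F] [SecondCountableTopology F]

theorem measurable_loss_comp (h : LearningSetting Y V Φ κ a₀ V₀) {α : Type*} [MeasurableSpace α]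
    {w : α → F} {p : α → X × Y} (hw : Measurable w) (hp : Measurable p) :
    Measurable fun s => loss V Φ (w s) (p s) := by
  have h1 : Measurable fun s => ((p s).2 : ℝ) := by fun_prop
  have h2 : Measurable fun s => Φ (p s).1 := h.measurable_feature.comp hp.fst
  exact h.measurable_loss.comp (h1.prodMk (hw.inner h2))

theorem integrable_loss (h : LearningSetting Y V Φ κ a₀ V₀) (ρ : Measure (X × Y))
    [IsFiniteMeasure ρ] (w : F) : Integrable (loss V Φ w) ρ :=
  Integrable.of_bound (h.measurable_loss_comp measurable_const measurable_id).aestronglyMeasurable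
    (V₀ + a₀ * κ * ‖w‖) (Eventually.of_forall fun p => h.abs_loss_le le_rfl p)

variable (ρ : Measure (X × Y)) [IsProbabilityMeasure ρ]

theorem abs_risk_sub_le (h : LearningSetting Y V Φ κ a₀ V₀) (w w' : F) :
    |risk ρ V Φ w - risk ρ V Φ w'| ≤ a₀ * κ * ‖w - w'‖ := by
  have e : risk ρ V Φ w - risk ρ V Φ w' = ∫ p, (loss V Φ w p - loss V Φ w' p) ∂ρ :=
    (integral_sub (h.integrable_loss ρ w) (h.integrable_loss ρ w')).symm
  rw [e]
  simpa using norm_integral_le_of_norm_le_const (μ := ρ)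
    (f := fun p => loss V Φ w p - loss V Φ w' p)
    (Eventually.of_forall fun p => h.abs_loss_sub_le w w' p)

theorem continuous_risk (h : LearningSetting Y V Φ κ a₀ V₀) : Continuous (risk ρ V Φ) :=
  (LipschitzWith.of_dist_le' (K := a₀ * κ) fun w w' => by
    simpa [Real.dist_eq, dist_eq_norm] using h.abs_risk_sub_le ρ w w').continuous

theorem continuous_empRisk (h : LearningSetting Y V Φ κ a₀ V₀) {m : ℕ} (z : Fin m → X × Y) :
    Continuous (empRisk V Φ z) := by
  refine continuous_const.mul (continuous_finsetSum _ fun k _ => ?_)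
  exact (LipschitzWith.of_dist_le' (K := a₀ * κ) fun w w' => by
    simpa [Real.dist_eq, dist_eq_norm] using h.abs_loss_sub_le w w' (z k)).continuous

theorem risk_nonneg (h : LearningSetting Y V Φ κ a₀ V₀) (w : F) : 0 ≤ risk ρ V Φ w :=
  integral_nonneg fun p => h.loss_nonneg' w p

theorem infRisk_nonneg (h : LearningSetting Y V Φ κ a₀ V₀) : 0 ≤ infRisk ρ V Φ :=
  le_ciInf fun w => h.risk_nonneg ρ w

theorem risk_le (h : LearningSetting Y V Φ κ a₀ V₀) {w : F} {R : ℝ} (hw : ‖w‖ ≤ R) :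
    risk ρ V Φ w ≤ V₀ + a₀ * κ * R := by
  have := norm_integral_le_of_norm_le_const (μ := ρ) (f := loss V Φ w)
    (Eventually.of_forall fun p => h.abs_loss_le hw p)
  simp only [probReal_univ, mul_one] at this
  exact (le_abs_self _).trans this

theorem convexOn_risk (h : LearningSetting Y V Φ κ a₀ V₀) :
    ConvexOn ℝ Set.univ (risk ρ V Φ) := by
  refine ⟨convex_univ, fun w _ w' _ a b ha hb hab => ?_⟩
  have e : a • risk ρ V Φ w + b • risk ρ V Φ w' =
      ∫ p, (a * loss V Φ w p + b * loss V Φ w' p) ∂ρ := by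
    rw [integral_add ((h.integrable_loss ρ w).const_mul a) ((h.integrable_loss ρ w').const_mul b),
      integral_const_mul, integral_const_mul]
    rfl
  rw [e]
  exact integral_mono (h.integrable_loss ρ _)
    (((h.integrable_loss ρ w).const_mul a).add ((h.integrable_loss ρ w').const_mul b))
    fun p => (h.convexOn_loss p).2 trivial trivial ha hb hab

/-- Uniform deviation of the risk from the empirical risk over a ball. -/
theorem exists_uniform_deviation (h : LearningSetting Y V Φ κ a₀ V₀) {m : ℕ} (hm : 1 ≤ m)
    {R : ℝ} (hR : 0 ≤ R) :
    ∃ G : (Fin m → X × Y) → ℝ, Integrable G (Measure.pi fun _ => ρ) ∧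
      (∀ z w, ‖w‖ ≤ R → risk ρ V Φ w - empRisk V Φ z w ≤ G z) ∧
      ∫ z, G z ∂(Measure.pi fun _ => ρ) ≤ 2 * (a₀ * κ * R) / Real.sqrt m := by
  obtain ⟨p₀⟩ := nonempty_of_isProbabilityMeasure ρ
  have ha := h.slope_bound_nonneg p₀
  have hκ := h.feature_bound_nonneg p₀
  have hm0 : (0 : ℝ) < m := by exact_mod_cast hm
  have : Nonempty (Metric.closedBall (0 : F) R) := ⟨⟨0, by simpa using hR⟩⟩
  -- A countable dense family makes the supremum measurable; continuity of both risks extends the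
  -- bound to the whole ball.
  set d : ℕ → Metric.closedBall (0 : F) R := TopologicalSpace.denseSeq _ with hd
  have hdR : ∀ i, ‖(d i : F)‖ ≤ R := fun i => mem_closedBall_zero_iff.1 (d i).2
  have hdd : DenseRange d := TopologicalSpace.denseRange_denseSeq _
  set f : ℕ → X × Y → ℝ := fun i => loss V Φ (d i : F) with hf
  have hfm : ∀ i, Measurable (f i) := fun i => h.measurable_loss_comp measurable_const measurable_id
  set B := V₀ + a₀ * κ * R with hB
  have hfB : ∀ i p, |f i p| ≤ B := fun i p => h.abs_loss_le (hdR i) p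
  have hrisk : ∀ i, ∫ p, f i p ∂ρ = risk ρ V Φ (d i) := fun i => rfl
  have hrB : ∀ i, |risk ρ V Φ (d i)| ≤ B := fun i => by
    rw [abs_of_nonneg (h.risk_nonneg ρ _)]
    exact h.risk_le ρ (hdR i)
  have habs : ∀ i (z : Fin m → X × Y), |∑ k, ((∫ p, f i p ∂ρ) - f i (z k))| ≤ m * (B + B) := by
    intro i z
    refine (Finset.abs_sum_le_sum_abs _ _).trans ?_
    refine (Finset.sum_le_sum fun k _ => (?_ : _ ≤ B + B)).trans (by simp [mul_add])
    exact (abs_sub _ _).trans (add_le_add (hrB i) (hfB i _))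
  have hsm : ∀ i, Measurable fun z : Fin m → X × Y => ∑ k, ((∫ p, f i p ∂ρ) - f i (z k)) :=
    fun i => Finset.measurable_sum _ fun k _ =>
      measurable_const.sub ((hfm i).comp (measurable_pi_apply k))
  refine ⟨fun z => (m : ℝ)⁻¹ * ⨆ i, ∑ k, ((∫ p, f i p ∂ρ) - f i (z k)), ?_, ?_, ?_⟩
  · exact (integrable_ciSup hsm habs).const_mul _
  · intro z w hw
    have key : ∀ w : Metric.closedBall (0 : F) R,
        risk ρ V Φ w - empRisk V Φ z w ≤
          (m : ℝ)⁻¹ * ⨆ i, ∑ k, ((∫ p, f i p ∂ρ) - f i (z k)) := by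
      intro w
      refine hdd.induction_on (p := fun w =>
        risk ρ V Φ (w : F) - empRisk V Φ z w ≤
          (m : ℝ)⁻¹ * ⨆ i, ∑ k, ((∫ p, f i p ∂ρ) - f i (z k))) w ?_ fun i => ?_
      · have c1 : Continuous fun w : Metric.closedBall (0 : F) R => risk ρ V Φ (w : F) :=
          (h.continuous_risk ρ).comp continuous_subtype_val
        have c2 : Continuous fun w : Metric.closedBall (0 : F) R => empRisk V Φ z (w : F) :=
          (h.continuous_empRisk z).comp continuous_subtype_val
        exact isClosed_le (c1.sub c2) continuous_const
      · have h1 := le_ciSup (bddAbove_of_abs fun i => habs i z) i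
        have h2 : risk ρ V Φ (d i) - empRisk V Φ z (d i) =
            (m : ℝ)⁻¹ * ∑ k, ((∫ p, f i p ∂ρ) - f i (z k)) := by
          rw [Finset.sum_sub_distrib, mul_sub, hrisk]
          simp only [Finset.sum_const, Finset.card_univ, Fintype.card_fin, nsmul_eq_mul]
          rw [inv_mul_cancel_left₀ hm0.ne']
          rfl
        change risk ρ V Φ (d i) - empRisk V Φ z (d i) ≤ _
        rw [h2]
        gcongr
    exact key ⟨w, by simpa using hw⟩
  · have hsym := two_pow_mul_integral_ciSup_le ρ hfm hfB m
    have hRi : ∀ σ : Fin m → Bool, Integrable (fun z : Fin m → X × Y =>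
        ⨆ i, ∑ k, sgn (σ k) * f i (z k)) (Measure.pi fun _ => ρ) := fun σ =>
      integrable_ciSup (fun i => Finset.measurable_sum _ fun k _ =>
        ((hfm i).comp (measurable_pi_apply k)).const_mul _)
        fun i z => abs_sum_sgn_mul_le σ fun k => hfB i (z k)
    rw [← integral_finsetSum _ fun σ _ => hRi σ] at hsym
    -- The loss is `a₀`-Lipschitz in the prediction, so contraction replaces it by `a₀` times a
    -- linear functional, whose supremum over the ball is controlled by the norm of the signed sum
    -- of features.
    have hpt : ∀ z : Fin m → X × Y, ∑ σ : Fin m → Bool, ⨆ i, ∑ k, sgn (σ k) * f i (z k) ≤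
        a₀ * R * (2 ^ m * (Real.sqrt m * κ)) := by
      intro z
      have hin : ∀ i k, |a₀ * inner ℝ (d i : F) (Φ (z k).1)| ≤ a₀ * (R * κ) := fun i k => by
        rw [abs_mul, abs_of_nonneg ha]
        gcongr
        refine (abs_real_inner_le_norm _ _).trans ?_
        exact mul_le_mul (hdR i) (h.norm_feature_le _) (norm_nonneg _) hR
      have c := sum_signs_ciSup_le (B := max B (a₀ * (R * κ))) m 0 (fun _ : ℕ => 0)
        (fun k i => f i (z k)) (fun k i => a₀ * inner ℝ (d i : F) (Φ (z k).1)) (by simp)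
        (fun k i => (hfB i _).trans (le_max_left _ _)) (fun k i => (hin i k).trans (le_max_right _ _))
        (fun k i j => by
          rw [← mul_sub, abs_mul, abs_of_nonneg ha]
          exact (le_abs_self _).trans (abs_sub_le_of_leftDeriv_bound
            (h.convex (z k).2 (z k).2.2) (h.leftDeriv_bound (z k).2 (z k).2.2) _ _))
      simp only [zero_add] at c
      refine c.trans ?_
      refine le_trans ?_ (mul_le_mul_of_nonneg_left (sum_signs_norm_le hκ
        (fun k => Φ (z k).1) fun k => h.norm_feature_le _) (by positivity : 0 ≤ a₀ * R))
      rw [Finset.mul_sum]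
      refine Finset.sum_le_sum fun σ _ => ciSup_le fun i => ?_
      have e : ∑ k, sgn (σ k) * (a₀ * inner ℝ (d i : F) (Φ (z k).1)) =
          a₀ * inner ℝ (d i : F) (∑ k, sgn (σ k) • Φ (z k).1) := by
        rw [inner_sum, Finset.mul_sum]
        refine Finset.sum_congr rfl fun k _ => ?_
        rw [inner_smul_right]
        ring
      rw [e, mul_assoc]
      gcongr
      refine (real_inner_le_norm _ _).trans ?_
      gcongr
      exact hdR i
    have hle := integral_mono (μ := Measure.pi fun _ : Fin m => ρ)
      (integrable_finsetSum Finset.univ fun σ _ => hRi σ)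
      (integrable_const (a₀ * R * (2 ^ m * (Real.sqrt m * κ)))) hpt
    rw [integral_const, probReal_univ, one_smul] at hle
    rw [integral_const_mul]
    have h2 : (0 : ℝ) < 2 ^ m := by positivity
    have h3 : ∫ z, ⨆ i, ∑ k : Fin m, ((∫ x, f i x ∂ρ) - f i (z k)) ∂(Measure.pi fun _ => ρ) ≤
        2 * (a₀ * κ * R) * Real.sqrt m := by
      refine le_of_mul_le_mul_left ?_ h2
      nlinarith
    have hs : 0 < Real.sqrt m := Real.sqrt_pos.2 hm0
    rw [inv_mul_le_iff₀ hm0]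
    refine h3.trans (le_of_eq ?_)
    have := Real.mul_self_sqrt hm0.le
    field_simp
    rw [pow_two, this]

end LearningSetting

end Setting

/-! ### Averaging out a uniformly drawn index -/

section Sampling

theorem measurePreserving_uniformOn_perm {m : ℕ} (π : Equiv.Perm (Fin m)) :
    MeasurePreserving π (uniformOn (Set.univ : Set (Fin m))) (uniformOn Set.univ) := by
  refine ⟨measurable_of_finite _, Measure.ext_of_singleton fun a => ?_⟩
  have e : π ⁻¹' {a} = {π.symm a} := by
    ext x
    simp [Equiv.eq_symm_apply]
  rw [Measure.map_apply (measurable_of_finite _) (measurableSet_singleton a), e, uniformOn_univ,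
    uniformOn_univ, Measure.count_singleton, Measure.count_singleton]

instance isProbabilityMeasure_uniformOn_fin {m : ℕ} [NeZero m] :
    IsProbabilityMeasure (uniformOn (Set.univ : Set (Fin m))) :=
  isProbabilityMeasure_uniformOn Set.finite_univ Set.univ_nonempty

variable {X : Type u} [MeasurableSpace X] {Y : Set ℝ} {m : ℕ} [NeZero m]
  (ρ : Measure (X × Y)) [IsProbabilityMeasure ρ]

instance isProbabilityMeasure_sampleLaw : IsProbabilityMeasure (sampleLaw ρ m) := by
  unfold sampleLaw
  infer_instance

theorem measurePreserving_fst_sampleLaw :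
    MeasurePreserving Prod.fst (sampleLaw ρ m) (Measure.pi fun _ => ρ) :=
  measurePreserving_fst

/-- This invariance is the form in which uniformity of `j_t` and its independence from everything
else are used. -/
theorem measurePreserving_sampleLaw_perm (t : ℕ) (π : Equiv.Perm (Fin m)) :
    MeasurePreserving
      (fun s : (Fin m → X × Y) × (ℕ → Fin m) =>
        (s.1, fun k => (if k = t then π else Equiv.refl _) (s.2 k)))
      (sampleLaw ρ m) (sampleLaw ρ m) := by
  have hf : ∀ k, MeasurePreserving ⇑(if k = t then π else Equiv.refl (Fin m))
      (uniformOn (Set.univ : Set (Fin m))) (uniformOn Set.univ) := fun k =>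
    measurePreserving_uniformOn_perm _
  have h2 : MeasurePreserving
      (fun (j : ℕ → Fin m) k => (if k = t then π else Equiv.refl _) (j k))
      (Measure.infinitePi fun _ : ℕ => uniformOn (Set.univ : Set (Fin m)))
      (Measure.infinitePi fun _ : ℕ => uniformOn Set.univ) := by
    refine ⟨measurable_pi_lambda _ fun k => (hf k).measurable.comp (measurable_pi_apply k), ?_⟩
    have := Measure.infinitePi_map_pi (μ := fun _ : ℕ => uniformOn (Set.univ : Set (Fin m)))
      fun k => (hf k).measurable
    rw [this]
    congr 1
    funext k
    exact (hf k).map_eq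
  exact (MeasurePreserving.id _).prod h2

/-- An index which the integrand only sees through its last argument may be averaged out. -/
theorem integral_sampleLaw_index {t : ℕ}
    {φ : (Fin m → X × Y) × (ℕ → Fin m) → Fin m → ℝ} (hφ : ∀ i, Measurable fun s => φ s i)
    {B : ℝ} (hB : ∀ s i, |φ s i| ≤ B)
    (hu : ∀ z j j', (∀ k, k ≠ t → j k = j' k) → φ (z, j) = φ (z, j')) :
    ∫ s, φ s (s.2 t) ∂(sampleLaw ρ m) = ∫ s, (m : ℝ)⁻¹ * ∑ i, φ s i ∂(sampleLaw ρ m) := by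
  have hψ : Measurable fun s : (Fin m → X × Y) × (ℕ → Fin m) => φ s (s.2 t) := by
    have : Measurable fun p : ((Fin m → X × Y) × (ℕ → Fin m)) × Fin m => φ p.1 p.2 :=
      measurable_from_prod_countable_left hφ
    exact this.comp (measurable_id.prodMk ((measurable_pi_apply t).comp measurable_snd))
  -- Shift the `t`-th index cyclically by `c`. Only the last argument of `φ` notices, and as `c`
  -- varies the shifted index runs once through `Fin m`, so summing over `c` produces the full sum.
  have key : ∀ c : Fin m, ∫ s, φ s (s.2 t) ∂(sampleLaw ρ m) =
      ∫ s, φ s (s.2 t + c) ∂(sampleLaw ρ m) := fun c => by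
    have hT := measurePreserving_sampleLaw_perm ρ t (Equiv.addRight c)
    conv_lhs => rw [← hT.map_eq, integral_map hT.measurable.aemeasurable
      hψ.aestronglyMeasurable]
    refine integral_congr_ae (Eventually.of_forall fun s => ?_)
    simp only [if_true, Equiv.coe_addRight]
    rw [hu s.1 _ s.2 fun k hk => by simp [hk]]
  have hint : ∀ c : Fin m, Integrable (fun s => φ s (s.2 t + c)) (sampleLaw ρ m) := fun c => by
    refine Integrable.of_bound ?_ B (Eventually.of_forall fun s => hB _ _)
    have : Measurable fun p : ((Fin m → X × Y) × (ℕ → Fin m)) × Fin m => φ p.1 p.2 :=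
      measurable_from_prod_countable_left hφ
    have h2 : Measurable fun s : (Fin m → X × Y) × (ℕ → Fin m) => s.2 t + c :=
      (measurable_of_finite fun a : Fin m => a + c).comp
        ((measurable_pi_apply t).comp measurable_snd)
    exact (this.comp (measurable_id.prodMk h2)).aestronglyMeasurable
  have hsum : ∑ _c : Fin m, ∫ s, φ s (s.2 t) ∂(sampleLaw ρ m) =
      ∫ s, ∑ i, φ s i ∂(sampleLaw ρ m) := by
    rw [Finset.sum_congr rfl fun c _ => key c, ← integral_finsetSum _ fun c _ => hint c]
    refine integral_congr_ae (Eventually.of_forall fun s => ?_)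
    exact Equiv.sum_comp (Equiv.addLeft (s.2 t)) (φ s)
  have hm : (m : ℝ) ≠ 0 := by exact_mod_cast NeZero.ne m
  rw [integral_const_mul, ← hsum]
  simp only [Finset.sum_const, Finset.card_univ, Fintype.card_fin, nsmul_eq_mul]
  rw [inv_mul_cancel_left₀ hm]

end Sampling

/-! ### Pathwise properties of the iterates -/

section Iterates

theorem measurable_sample_index {X : Type u} [MeasurableSpace X] {Y : Set ℝ} {m : ℕ} (t : ℕ) :
    Measurable fun s : (Fin m → X × Y) × (ℕ → Fin m) => s.1 (s.2 t) := by
  have : Measurable fun q : (Fin m → X × Y) × Fin m => q.1 q.2 :=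
    measurable_from_prod_countable_left fun i => measurable_pi_apply i
  exact this.comp (measurable_fst.prodMk ((measurable_pi_apply t).comp measurable_snd))

variable {X : Type u} [MeasurableSpace X] {Y : Set ℝ}
  {F : Type v} [NormedAddCommGroup F] [InnerProductSpace ℝ F]
  {V : ℝ → ℝ → ℝ} {Φ : X → F} {κ a₀ V₀ : ℝ} {η : ℕ → ℝ} {m : ℕ}

theorem iterate_succ (z : Fin m → X × Y) (j : ℕ → Fin m) {t : ℕ} (ht : 1 ≤ t) :
    iterate V Φ η z j (t + 1) = iterate V Φ η z j t -
      (η t * leftDeriv (V (z (j t)).2)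
        (inner ℝ (iterate V Φ η z j t) (Φ (z (j t)).1))) • Φ (z (j t)).1 := by
  obtain ⟨t, rfl⟩ := Nat.exists_eq_add_of_le' ht
  rfl

/-- The iterates are adapted: `w_t` does not see `j_t`, which can therefore be averaged out at step
`t`. -/
theorem iterate_congr (z : Fin m → X × Y) {j j' : ℕ → Fin m} :
    ∀ {t : ℕ}, (∀ k, k < t → j k = j' k) → iterate V Φ η z j t = iterate V Φ η z j' t
  | 0, _ => rfl
  | 1, _ => rfl
  | t + 2, h => by
    have ih := iterate_congr z (t := t + 1) fun k hk => h k (by omega)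
    rw [iterate_succ z j (by omega), iterate_succ z j' (by omega), ih, h (t + 1) (by omega)]

namespace LearningSetting

variable [MeasurableSpace F]

/-- Expand the square: the subgradient inequality handles the cross term, and the bounds on slope
and feature the quadratic one. -/
theorem norm_sub_step_sq_le (h : LearningSetting Y V Φ κ a₀ V₀) {e : ℝ} (he : 0 ≤ e) (w u : F)
    (p : X × Y) :
    ‖w - (e * leftDeriv (V p.2) (inner ℝ w (Φ p.1))) • Φ p.1 - u‖ ^ 2 ≤
      ‖w - u‖ ^ 2 + e ^ 2 * (a₀ * κ) ^ 2 - 2 * e * (loss V Φ w p - loss V Φ u p) := by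
  set g := leftDeriv (V p.2) (inner ℝ w (Φ p.1)) with hg
  have e1 : w - (e * g) • Φ p.1 - u = (w - u) - (e * g) • Φ p.1 := by abel
  rw [e1, norm_sub_sq_real, inner_smul_right, norm_smul, inner_sub_left]
  have h1 := h.loss_add_le w u p
  rw [← hg] at h1
  have h2 : |g| ≤ a₀ := h.leftDeriv_bound p.2 p.2.2 _
  have h3 : (‖e * g‖ * ‖Φ p.1‖) ^ 2 ≤ e ^ 2 * (a₀ * κ) ^ 2 := by
    rw [← mul_pow]
    have : ‖e * g‖ * ‖Φ p.1‖ ≤ e * (a₀ * κ) := by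
      rw [Real.norm_eq_abs, abs_mul, abs_of_nonneg he, mul_assoc]
      gcongr
      · exact (abs_nonneg _).trans h2
      · exact h.norm_feature_le _
    gcongr
  have h4 := mul_le_mul_of_nonneg_left h1 (by linarith : 0 ≤ 2 * e)
  linarith

/-- Take `u = 0` in the one-step inequality: the loss is at most `V₀` at `0` and nonnegative at the
iterate, so each step adds a constant, whatever the sample. -/
theorem norm_iterate_sq_le (h : LearningSetting Y V Φ κ a₀ V₀) {e : ℝ} (he : 0 ≤ e)
    (hη : ∀ t, 1 ≤ t → η t = e) (z : Fin m → X × Y) (j : ℕ → Fin m) (t : ℕ) :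
    ‖iterate V Φ η z j (t + 1)‖ ^ 2 ≤ t * (e ^ 2 * (a₀ * κ) ^ 2 + 2 * e * V₀) := by
  induction t with
  | zero => simp [iterate]
  | succ t ih =>
    rw [iterate_succ z j (by omega), hη _ (by omega)]
    have h1 := h.norm_sub_step_sq_le he (iterate V Φ η z j (t + 1)) 0 (z (j (t + 1)))
    rw [sub_zero, sub_zero] at h1
    have h2 : loss V Φ 0 (z (j (t + 1))) ≤ V₀ := by
      simpa [loss] using h.loss_zero_le (z (j (t + 1)))
    have h3 := h.loss_nonneg' (iterate V Φ η z j (t + 1)) (z (j (t + 1)))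
    have h4 : 2 * e * (loss V Φ 0 (z (j (t + 1))) -
        loss V Φ (iterate V Φ η z j (t + 1)) (z (j (t + 1)))) ≤ 2 * e * V₀ := by
      gcongr
      linarith
    push_cast
    linarith

theorem norm_iterate_le (h : LearningSetting Y V Φ κ a₀ V₀) {e : ℝ} (he : 0 ≤ e)
    (hη : ∀ t, 1 ≤ t → η t = e) (z : Fin m → X × Y) (j : ℕ → Fin m) {k t : ℕ} (hk : 1 ≤ k)
    (hkt : k ≤ t + 1) :
    ‖iterate V Φ η z j k‖ ≤ Real.sqrt (t * (e ^ 2 * (a₀ * κ) ^ 2 + 2 * e * V₀)) := by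
  obtain ⟨k, rfl⟩ := Nat.exists_eq_add_of_le' hk
  have hV := h.loss_zero_bound_nonneg (z (j 0))
  refine Real.le_sqrt_of_sq_le ((h.norm_iterate_sq_le he hη z j k).trans ?_)
  have : (k : ℝ) ≤ t := by exact_mod_cast (by omega : k ≤ t)
  gcongr

variable [BorelSpace F] [SecondCountableTopology F]

theorem measurable_iterate (h : LearningSetting Y V Φ κ a₀ V₀) : ∀ t : ℕ,
    Measurable fun s : (Fin m → X × Y) × (ℕ → Fin m) => iterate V Φ η s.1 s.2 t
  | 0 => measurable_const
  | 1 => measurable_const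
  | t + 2 => by
    have ih := measurable_iterate h (t + 1)
    have hp := measurable_sample_index (X := X) (Y := Y) (m := m) (t + 1)
    have hΦ : Measurable fun s : (Fin m → X × Y) × (ℕ → Fin m) => Φ (s.1 (s.2 (t + 1))).1 :=
      h.measurable_feature.comp hp.fst
    have hy : Measurable fun s : (Fin m → X × Y) × (ℕ → Fin m) =>
        ((s.1 (s.2 (t + 1))).2 : ℝ) := measurable_subtype_coe.comp hp.snd
    have hd := measurable_leftDeriv h.measurable_loss hy (ih.inner hΦ)
      fun s => h.convex _ (s.1 (s.2 (t + 1))).2.2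
    exact ih.sub ((hd.const_mul _).smul hΦ)

end LearningSetting

end Iterates

/-- Compare averages over the last `k + 1` and the last `k + 2` terms. The hypothesis on the block
starting at `t - (k + 1)` bounds the loss in lengthening the tail by `b / (k + 1)`; these losses sum
to `b` times a harmonic number. -/
theorem last_le_average_add_log {a : ℕ → ℝ} {b : ℝ} (hb : 0 ≤ b) {t : ℕ} (ht : 1 ≤ t)
    (ha : ∀ k₀ n, 1 ≤ k₀ → ∑ i ∈ Finset.range n, (a (k₀ + i) - a k₀) ≤ n * b) :
    a t ≤ (∑ k ∈ Finset.Icc 1 t, a k) / t + b * (1 + Real.log t) := by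
  have key : ∀ k, k + 1 ≤ t →
      a t ≤ (∑ i ∈ Finset.range (k + 1), a (t - i)) / (k + 1) + b * (harmonic k : ℝ) := by
    intro k
    induction k with
    | zero => intro _; simp
    | succ k ih =>
      intro hk
      have h1 := ih (by omega)
      have h2 := ha (t - (k + 1)) (k + 2) (by omega)
      rw [Finset.sum_sub_distrib, ← Finset.sum_range_reflect] at h2
      have e : ∑ i ∈ Finset.range (k + 2), a (t - (k + 1) + (k + 2 - 1 - i)) =
          ∑ i ∈ Finset.range (k + 2), a (t - i) := by
        refine Finset.sum_congr rfl fun i hi => ?_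
        rw [Finset.mem_range] at hi
        congr 1
        omega
      rw [e] at h2
      simp only [Finset.sum_const, Finset.card_range, nsmul_eq_mul] at h2
      rw [Finset.sum_range_succ] at h2 ⊢
      rw [harmonic_succ]
      push_cast at h2 ⊢
      set S := ∑ i ∈ Finset.range (k + 1), a (t - i) with hS
      set r := a (t - (k + 1)) with hr
      have hk1 : (0 : ℝ) < (k : ℝ) + 1 := by positivity
      have hk2 : (0 : ℝ) < (k : ℝ) + 1 + 1 := by positivity
      refine h1.trans ?_
      -- The two averages differ by `(S - (k + 1) * r) / ((k + 1) * (k + 2))`, and `h2` says `S - (k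
      -- + 1) * r ≤ (k + 2) * b`.
      have h3 : S / ((k : ℝ) + 1) ≤ (S + r) / ((k : ℝ) + 1 + 1) + b * ((k : ℝ) + 1)⁻¹ := by
        rw [← div_eq_mul_inv, div_add_div _ _ hk2.ne' hk1.ne', div_le_div_iff₀ hk1 (by positivity)]
        nlinarith [mul_le_mul_of_nonneg_right h2 hk1.le]
      linarith
  have h := key (t - 1) (by omega)
  have e1 : t - 1 + 1 = t := by omega
  have e2 : ((t - 1 : ℕ) : ℝ) + 1 = t := by exact_mod_cast e1
  rw [e1, e2] at h
  have e3 : ∑ i ∈ Finset.range t, a (t - i) = ∑ k ∈ Finset.Icc 1 t, a k := by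
    refine Finset.sum_nbij' (fun i => t - i) (fun k => t - k) ?_ ?_ ?_ ?_ fun _ _ => rfl <;>
    · intro i hi
      simp only [Finset.mem_range, Finset.mem_Icc] at hi ⊢
      omega
  rw [e3] at h
  refine h.trans ?_
  have h4 : (harmonic (t - 1) : ℝ) ≤ 1 + Real.log t := by
    refine le_trans ?_ (harmonic_le_one_add_log t)
    conv_rhs => rw [← e1, harmonic_succ]
    push_cast
    have : (0 : ℝ) ≤ (((t - 1 : ℕ) : ℝ) + 1)⁻¹ := by positivity
    linarith
  gcongr

/-! ### Expected progress of the method -/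

section Expectation

/-- Bounded measurable random vectors. -/
structure BoundedMeasurable {Ω F : Type*} [MeasurableSpace Ω] [NormedAddCommGroup F]
    [MeasurableSpace F] (w : Ω → F) : Prop where
  measurable : Measurable w
  bounded : ∃ R, ∀ s, ‖w s‖ ≤ R

theorem BoundedMeasurable.const {Ω F : Type*} [MeasurableSpace Ω] [NormedAddCommGroup F]
    [MeasurableSpace F] (w : F) : BoundedMeasurable fun _ : Ω => w :=
  ⟨measurable_const, ‖w‖, fun _ => le_rfl⟩

variable {X : Type u} [MeasurableSpace X] {Y : Set ℝ}
  {F : Type v} [NormedAddCommGroup F] [InnerProductSpace ℝ F] [MeasurableSpace F] [BorelSpace F]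
  [SecondCountableTopology F]
  {V : ℝ → ℝ → ℝ} {Φ : X → F} {κ a₀ V₀ : ℝ} {η : ℕ → ℝ} {m : ℕ} [NeZero m]
  (ρ : Measure (X × Y)) [IsProbabilityMeasure ρ]

theorem BoundedMeasurable.integrable_norm_sub_sq {Ω : Type*} [MeasurableSpace Ω]
    {P : Measure Ω} [IsFiniteMeasure P] {w u : Ω → F} (hw : BoundedMeasurable w)
    (hu : BoundedMeasurable u) : Integrable (fun s => ‖w s - u s‖ ^ 2) P := by
  obtain ⟨R, hR⟩ := hw.bounded
  obtain ⟨R', hR'⟩ := hu.bounded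
  refine Integrable.of_bound
    ((hw.measurable.sub hu.measurable).norm.pow_const 2).aestronglyMeasurable ((R + R') ^ 2)
    (Eventually.of_forall fun s => ?_)
  rw [Real.norm_eq_abs, abs_of_nonneg (by positivity)]
  have := (norm_sub_le (w s) (u s)).trans (add_le_add (hR s) (hR' s))
  gcongr

namespace LearningSetting

theorem boundedMeasurable_iterate (h : LearningSetting Y V Φ κ a₀ V₀) {e : ℝ} (he : 0 ≤ e)
    (hη : ∀ t, 1 ≤ t → η t = e) {k : ℕ} (hk : 1 ≤ k) :
    BoundedMeasurable fun s : (Fin m → X × Y) × (ℕ → Fin m) => iterate V Φ η s.1 s.2 k :=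
  ⟨h.measurable_iterate k, _, fun s => h.norm_iterate_le he hη s.1 s.2 (t := k) hk (by omega)⟩

theorem integrable_loss_comp (h : LearningSetting Y V Φ κ a₀ V₀) {Ω : Type*} [MeasurableSpace Ω]
    {P : Measure Ω} [IsFiniteMeasure P] {w : Ω → F} (hw : BoundedMeasurable w) {p : Ω → X × Y}
    (hp : Measurable p) : Integrable (fun s => loss V Φ (w s) (p s)) P := by
  obtain ⟨R, hR⟩ := hw.bounded
  exact Integrable.of_bound (h.measurable_loss_comp hw.measurable hp).aestronglyMeasurable
    (V₀ + a₀ * κ * R) (Eventually.of_forall fun s => h.abs_loss_le (hR s) _)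

theorem integrable_empRisk (h : LearningSetting Y V Φ κ a₀ V₀)
    {w : (Fin m → X × Y) × (ℕ → Fin m) → F} (hw : BoundedMeasurable w) :
    Integrable (fun s => empRisk V Φ s.1 (w s)) (sampleLaw ρ m) :=
  (integrable_finsetSum _ fun k _ => h.integrable_loss_comp hw
    ((measurable_pi_apply k).comp measurable_fst)).const_mul _

theorem integrable_risk (h : LearningSetting Y V Φ κ a₀ V₀) {Ω : Type*} [MeasurableSpace Ω]
    {P : Measure Ω} [IsFiniteMeasure P] {w : Ω → F} (hw : BoundedMeasurable w) :
    Integrable (fun s => risk ρ V Φ (w s)) P := by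
  obtain ⟨R, hR⟩ := hw.bounded
  refine Integrable.of_bound
    ((h.continuous_risk ρ).measurable.comp hw.measurable).aestronglyMeasurable
    (V₀ + a₀ * κ * R) (Eventually.of_forall fun s => ?_)
  rw [Real.norm_eq_abs, abs_of_nonneg (h.risk_nonneg ρ _)]
  exact h.risk_le ρ (hR s)

theorem integral_empRisk_const (h : LearningSetting Y V Φ κ a₀ V₀) (w : F) :
    ∫ s, empRisk V Φ s.1 w ∂(sampleLaw ρ m) = risk ρ V Φ w := by
  have hm : (m : ℝ) ≠ 0 := by exact_mod_cast NeZero.ne m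
  have hk : ∀ k : Fin m, ∫ s : (Fin m → X × Y) × (ℕ → Fin m), loss V Φ w (s.1 k)
      ∂(sampleLaw ρ m) = risk ρ V Φ w := fun k => by
    have hp : MeasurePreserving (fun s : (Fin m → X × Y) × (ℕ → Fin m) => s.1 k)
        (sampleLaw ρ m) ρ :=
      (measurePreserving_eval (fun _ : Fin m => ρ) k).comp (measurePreserving_fst_sampleLaw ρ)
    have := integral_map hp.measurable.aemeasurable (f := loss V Φ w) (μ := sampleLaw ρ m)
      (h.measurable_loss_comp measurable_const measurable_id).aestronglyMeasurable
    rw [hp.map_eq] at this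
    exact this.symm
  have hi : ∀ k : Fin m, Integrable (fun s : (Fin m → X × Y) × (ℕ → Fin m) =>
      loss V Φ w (s.1 k)) (sampleLaw ρ m) := fun k => h.integrable_loss_comp
    (BoundedMeasurable.const w) ((measurable_pi_apply k).comp measurable_fst)
  unfold empRisk
  rw [integral_const_mul, integral_finsetSum _ fun k _ => hi k,
    Finset.sum_congr rfl fun k _ => hk k]
  simp only [Finset.sum_const, Finset.card_univ, Fintype.card_fin, nsmul_eq_mul]
  rw [inv_mul_cancel_left₀ hm]

/-- The expected progress of one step towards a point chosen before that step. -/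
theorem two_mul_integral_empRisk_sub_le (h : LearningSetting Y V Φ κ a₀ V₀) {e : ℝ} (he : 0 ≤ e)
    (hη : ∀ t, 1 ≤ t → η t = e) {k : ℕ} (hk : 1 ≤ k) {u : (Fin m → X × Y) × (ℕ → Fin m) → F}
    (hu : BoundedMeasurable u)
    (huk : ∀ z j j', (∀ i, i < k → j i = j' i) → u (z, j) = u (z, j')) :
    2 * e * ((∫ s, empRisk V Φ s.1 (iterate V Φ η s.1 s.2 k) ∂(sampleLaw ρ m)) -
        ∫ s, empRisk V Φ s.1 (u s) ∂(sampleLaw ρ m)) ≤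
      (∫ s, ‖iterate V Φ η s.1 s.2 k - u s‖ ^ 2 ∂(sampleLaw ρ m)) -
        (∫ s, ‖iterate V Φ η s.1 s.2 (k + 1) - u s‖ ^ 2 ∂(sampleLaw ρ m)) +
        e ^ 2 * (a₀ * κ) ^ 2 := by
  set P := sampleLaw ρ m with hP
  have hW := h.boundedMeasurable_iterate (η := η) (m := m) he hη hk
  have hW' := h.boundedMeasurable_iterate (η := η) (m := m) he hη (k := k + 1) (by omega)
  set W : (Fin m → X × Y) × (ℕ → Fin m) → F := fun s => iterate V Φ η s.1 s.2 k with hWd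
  set φ : (Fin m → X × Y) × (ℕ → Fin m) → Fin m → ℝ := fun s i =>
    loss V Φ (W s) (s.1 i) - loss V Φ (u s) (s.1 i) with hφ
  obtain ⟨R, hR⟩ := hW.bounded
  obtain ⟨R', hR'⟩ := hu.bounded
  have hφm : ∀ i, Measurable fun s => φ s i := fun i =>
    (h.measurable_loss_comp hW.measurable ((measurable_pi_apply i).comp measurable_fst)).sub
      (h.measurable_loss_comp hu.measurable ((measurable_pi_apply i).comp measurable_fst))
  -- Neither `w_k` nor `u` depends on `j_k`, so the loss gap at the drawn example averages to the
  -- gap of empirical risks.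
  have hres := integral_sampleLaw_index ρ (t := k) hφm
    (B := (V₀ + a₀ * κ * R) + (V₀ + a₀ * κ * R'))
    (fun s i => (abs_sub _ _).trans
      (add_le_add (h.abs_loss_le (hR s) _) (h.abs_loss_le (hR' s) _)))
    (fun z j j' hj => by
      have e1 := huk z j j' fun i hi => hj i hi.ne
      have e2 : iterate V Φ η z j k = iterate V Φ η z j' k :=
        iterate_congr z fun i hi => hj i hi.ne
      simp only [hφ, hWd, e1, e2])
  have hemp : ∫ s, (m : ℝ)⁻¹ * ∑ i, φ s i ∂P =
      (∫ s, empRisk V Φ s.1 (W s) ∂P) - ∫ s, empRisk V Φ s.1 (u s) ∂P := by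
    rw [← integral_sub (h.integrable_empRisk ρ hW) (h.integrable_empRisk ρ hu)]
    refine integral_congr_ae (Eventually.of_forall fun s => ?_)
    simp only [hφ, empRisk, Finset.sum_sub_distrib, mul_sub]
  rw [← hemp, ← hres]
  have hi1 : Integrable (fun s => φ s (s.2 k)) P :=
    (h.integrable_loss_comp hW (measurable_sample_index k)).sub
      (h.integrable_loss_comp hu (measurable_sample_index k))
  have hi2 : Integrable (fun s => ‖W s - u s‖ ^ 2) P := hW.integrable_norm_sub_sq hu
  have hi3 := hW'.integrable_norm_sub_sq (P := P) hu
  have hi4 : Integrable (fun s => ‖W s - u s‖ ^ 2 + e ^ 2 * (a₀ * κ) ^ 2) P :=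
    hi2.add (integrable_const _)
  have hi5 : Integrable (fun s => 2 * e * φ s (s.2 k)) P := hi1.const_mul _
  have hmono : ∫ s, ‖iterate V Φ η s.1 s.2 (k + 1) - u s‖ ^ 2 ∂P ≤
      ∫ s, (‖W s - u s‖ ^ 2 + e ^ 2 * (a₀ * κ) ^ 2 - 2 * e * φ s (s.2 k)) ∂P := by
    refine integral_mono hi3 (hi4.sub hi5) fun s => ?_
    simp only [iterate_succ s.1 s.2 hk, hη k hk]
    exact h.norm_sub_step_sq_le he (W s) (u s) (s.1 (s.2 k))
  rw [integral_sub hi4 hi5, integral_add hi2 (integrable_const _), integral_const,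
    integral_const_mul] at hmono
  simp only [probReal_univ, one_smul] at hmono
  linarith

/-- The one-step bounds telescope, since a target determined before step `k` is admissible at every
later step. -/
theorem two_mul_sum_integral_empRisk_sub_le (h : LearningSetting Y V Φ κ a₀ V₀) {e : ℝ}
    (he : 0 ≤ e) (hη : ∀ t, 1 ≤ t → η t = e) {k : ℕ} (hk : 1 ≤ k)
    {u : (Fin m → X × Y) × (ℕ → Fin m) → F} (hu : BoundedMeasurable u)
    (huk : ∀ z j j', (∀ i, i < k → j i = j' i) → u (z, j) = u (z, j')) (n : ℕ) :
    2 * e * ∑ i ∈ Finset.range n,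
        ((∫ s, empRisk V Φ s.1 (iterate V Φ η s.1 s.2 (k + i)) ∂(sampleLaw ρ m)) -
          ∫ s, empRisk V Φ s.1 (u s) ∂(sampleLaw ρ m)) ≤
      (∫ s, ‖iterate V Φ η s.1 s.2 k - u s‖ ^ 2 ∂(sampleLaw ρ m)) -
        (∫ s, ‖iterate V Φ η s.1 s.2 (k + n) - u s‖ ^ 2 ∂(sampleLaw ρ m)) +
        n * (e ^ 2 * (a₀ * κ) ^ 2) := by
  induction n with
  | zero => simp
  | succ n ih =>
    rw [Finset.sum_range_succ, mul_add]
    have := h.two_mul_integral_empRisk_sub_le ρ he hη (k := k + n) (by omega) hu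
      fun z j j' hj => huk z j j' fun i hi => hj i (by omega)
    rw [← add_assoc k n 1]
    push_cast
    linarith

end LearningSetting

end Expectation

theorem sum_Icc_one_eq_sum_range (a : ℕ → ℝ) (t : ℕ) :
    ∑ k ∈ Finset.Icc 1 t, a k = ∑ i ∈ Finset.range t, a (1 + i) := by
  refine Finset.sum_nbij' (fun k => k - 1) (fun i => 1 + i) ?_ ?_ ?_ ?_ ?_
  · intro i hi
    simp only [Finset.mem_range, Finset.mem_Icc] at hi ⊢
    omega
  · intro i hi
    simp only [Finset.mem_range, Finset.mem_Icc] at hi ⊢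
    omega
  · intro i hi
    simp only [Finset.mem_Icc] at hi
    omega
  · intro i _
    omega
  · intro i hi
    simp only [Finset.mem_Icc] at hi
    congr 1
    omega

/-! ### Empirical and expected risk bounds -/

namespace LearningSetting

variable {X : Type u} [MeasurableSpace X] {Y : Set ℝ}
  {F : Type v} [NormedAddCommGroup F] [InnerProductSpace ℝ F] [MeasurableSpace F] [BorelSpace F]
  [SecondCountableTopology F]
  {V : ℝ → ℝ → ℝ} {Φ : X → F} {κ a₀ V₀ : ℝ} {η : ℕ → ℝ} {m : ℕ} [NeZero m]
  (ρ : Measure (X × Y)) [IsProbabilityMeasure ρ]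

/-- For a fixed target `w` the empirical risk is unbiased and the initial squared distance is `‖w‖ ^
2`. Dividing by `2 * e * t` turns that distance into the penalty with parameter `1 / (e * t)`, and
`w` is then optimized. -/
theorem average_integral_empRisk_le (h : LearningSetting Y V Φ κ a₀ V₀) {e : ℝ} (he : 0 < e)
    (hη : ∀ t, 1 ≤ t → η t = e) {t : ℕ} (ht : 1 ≤ t) :
    (∑ k ∈ Finset.Icc 1 t,
        ∫ s, empRisk V Φ s.1 (iterate V Φ η s.1 s.2 k) ∂(sampleLaw ρ m)) / t ≤
      infRisk ρ V Φ + approxError ρ V Φ (1 / (e * t)) + e * (a₀ * κ) ^ 2 / 2 := by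
  have ht0 : (0 : ℝ) < t := by exact_mod_cast ht
  rw [approxError, add_sub_cancel, ← sub_le_iff_le_add]
  refine le_ciInf fun w => ?_
  have h1 := h.two_mul_sum_integral_empRisk_sub_le (m := m) ρ he.le hη le_rfl
    (BoundedMeasurable.const w) (fun _ _ _ _ => rfl) t
  rw [h.integral_empRisk_const ρ w, Finset.sum_sub_distrib] at h1
  simp only [Finset.sum_const, Finset.card_range, nsmul_eq_mul] at h1
  rw [← sum_Icc_one_eq_sum_range (fun k =>
    ∫ s, empRisk V Φ s.1 (iterate V Φ η s.1 s.2 k) ∂(sampleLaw ρ m))] at h1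
  set S := ∑ k ∈ Finset.Icc 1 t,
    ∫ s, empRisk V Φ s.1 (iterate V Φ η s.1 s.2 k) ∂(sampleLaw ρ m) with hS
  have h2 : ∫ s : (Fin m → X × Y) × (ℕ → Fin m), ‖iterate V Φ η s.1 s.2 1 - w‖ ^ 2
      ∂(sampleLaw ρ m) = ‖w‖ ^ 2 := by
    simp [iterate]
  have h3 : 0 ≤ ∫ s : (Fin m → X × Y) × (ℕ → Fin m), ‖iterate V Φ η s.1 s.2 (1 + t) - w‖ ^ 2
      ∂(sampleLaw ρ m) := integral_nonneg fun s => by positivity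
  rw [h2] at h1
  have h4 : 2 * e * (S - t * risk ρ V Φ w) ≤ ‖w‖ ^ 2 + t * (e ^ 2 * (a₀ * κ) ^ 2) := by linarith
  have e1 : risk ρ V Φ w + 1 / (e * t) / 2 * ‖w‖ ^ 2 + e * (a₀ * κ) ^ 2 / 2 =
      (2 * e * (t * risk ρ V Φ w) + (‖w‖ ^ 2 + t * (e ^ 2 * (a₀ * κ) ^ 2))) / (2 * e * t) := by
    field_simp
    ring
  rw [sub_le_iff_le_add, e1, div_le_div_iff₀ ht0 (by positivity)]
  nlinarith [mul_le_mul_of_nonneg_right h4 ht0.le]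

theorem integral_empRisk_iterate_le (h : LearningSetting Y V Φ κ a₀ V₀) {e : ℝ} (he : 0 < e)
    (hη : ∀ t, 1 ≤ t → η t = e) {t : ℕ} (ht : 1 ≤ t) :
    ∫ s, empRisk V Φ s.1 (iterate V Φ η s.1 s.2 t) ∂(sampleLaw ρ m) ≤
      infRisk ρ V Φ + approxError ρ V Φ (1 / (e * t)) +
        e * (a₀ * κ) ^ 2 / 2 * (2 + Real.log t) := by
  have h1 := last_le_average_add_log
    (a := fun k => ∫ s, empRisk V Φ s.1 (iterate V Φ η s.1 s.2 k) ∂(sampleLaw ρ m))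
    -- The target on the block starting at `k` is `w_k` itself, so the initial distance vanishes.
    (b := e * (a₀ * κ) ^ 2 / 2) (by positivity) ht (fun k n hk => by
      have h2 := h.two_mul_sum_integral_empRisk_sub_le (m := m) ρ he.le hη hk
        (h.boundedMeasurable_iterate he.le hη hk) (fun z j j' hj => iterate_congr z hj) n
      have h3 : 0 ≤ ∫ s : (Fin m → X × Y) × (ℕ → Fin m),
          ‖iterate V Φ η s.1 s.2 (k + n) - iterate V Φ η s.1 s.2 k‖ ^ 2 ∂(sampleLaw ρ m) :=
        integral_nonneg fun s => by positivity
      simp only [sub_self, norm_zero, ne_eq, OfNat.ofNat_ne_zero, not_false_eq_true, zero_pow,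
        integral_zero] at h2
      refine le_of_mul_le_mul_left (h2.trans ?_) (by positivity : 0 < 2 * e)
      have : (2 * e) * (n * (e * (a₀ * κ) ^ 2 / 2)) = n * (e ^ 2 * (a₀ * κ) ^ 2) := by ring
      rw [this]
      linarith)
  have h2 := h.average_integral_empRisk_le (m := m) ρ he hη ht
  linarith

/-- A bound on the expected gap between the risk and the empirical risk of an output of norm at
most `R`. -/
theorem integral_risk_le (h : LearningSetting Y V Φ κ a₀ V₀) {R : ℝ} (hR : 0 ≤ R)
    {w : (Fin m → X × Y) × (ℕ → Fin m) → F} (hw : Measurable w) (hwR : ∀ s, ‖w s‖ ≤ R) :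
    ∫ s, risk ρ V Φ (w s) ∂(sampleLaw ρ m) ≤
      (∫ s, empRisk V Φ s.1 (w s) ∂(sampleLaw ρ m)) + 2 * (a₀ * κ * R) / Real.sqrt m := by
  -- The output depends on the sample, so its gap needs a bound uniform over the ball.
  obtain ⟨G, hGi, hG, hGle⟩ := h.exists_uniform_deviation ρ (m := m) NeZero.one_le hR
  have hb : BoundedMeasurable w := ⟨hw, R, hwR⟩
  have hp := measurePreserving_fst_sampleLaw (m := m) ρ
  have hGi' : Integrable (fun s => G s.1) (sampleLaw ρ m) := hp.integrable_comp_of_integrable hGi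
  have e1 : ∫ s, G s.1 ∂(sampleLaw ρ m) = ∫ z, G z ∂(Measure.pi fun _ => ρ) := by
    have hGa := hGi.aestronglyMeasurable
    rw [← hp.map_eq] at hGa
    rw [← integral_map hp.measurable.aemeasurable hGa, hp.map_eq]
  have hmono := integral_mono ((h.integrable_risk ρ hb).sub (h.integrable_empRisk ρ hb)) hGi'
    fun s => hG s.1 (w s) (hwR s)
  rw [e1] at hmono
  have e2 := integral_sub (h.integrable_risk (P := sampleLaw ρ m) ρ hb) (h.integrable_empRisk ρ hb)
  simp only [Pi.sub_apply] at hmono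
  linarith

theorem integral_risk_iterate_le (h : LearningSetting Y V Φ κ a₀ V₀) {e : ℝ} (he : 0 < e)
    (hη : ∀ t, 1 ≤ t → η t = e) {t : ℕ} (ht : 1 ≤ t) :
    ∫ s, risk ρ V Φ (iterate V Φ η s.1 s.2 t) ∂(sampleLaw ρ m) ≤
      infRisk ρ V Φ + approxError ρ V Φ (1 / (e * t)) +
        e * (a₀ * κ) ^ 2 / 2 * (2 + Real.log t) +
        2 * (a₀ * κ * Real.sqrt (t * (e ^ 2 * (a₀ * κ) ^ 2 + 2 * e * V₀))) / Real.sqrt m := by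
  have h1 := h.integral_risk_le (m := m) ρ (Real.sqrt_nonneg _) (h.measurable_iterate t)
    fun s => h.norm_iterate_le he.le hη s.1 s.2 (t := t) ht (by omega)
  have h2 := h.integral_empRisk_iterate_le (m := m) ρ he hη ht
  linarith

theorem average_eq {e : ℝ} (he : 0 < e) (hη : ∀ t, 1 ≤ t → η t = e) (z : Fin m → X × Y)
    (j : ℕ → Fin m) (t : ℕ) :
    average V Φ η z j t = ∑ k ∈ Finset.Icc 1 t, (t : ℝ)⁻¹ • iterate V Φ η z j k := by
  have hk : ∀ k ∈ Finset.Icc 1 t, η k = e := fun k hk => hη k (Finset.mem_Icc.1 hk).1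
  have hk' : ∀ k ∈ Finset.Icc 1 t,
      η k • iterate V Φ η z j k = e • iterate V Φ η z j k := fun k h => by rw [hk k h]
  rw [average, Finset.sum_congr rfl hk, Finset.sum_congr rfl hk', ← Finset.smul_sum,
    ← Finset.smul_sum, smul_smul]
  congr 1
  simp only [Finset.sum_const, Nat.card_Icc, add_tsub_cancel_right, nsmul_eq_mul]
  field_simp

theorem boundedMeasurable_average (h : LearningSetting Y V Φ κ a₀ V₀) {e : ℝ} (he : 0 < e)
    (hη : ∀ t, 1 ≤ t → η t = e) (t : ℕ) :
    BoundedMeasurable fun s : (Fin m → X × Y) × (ℕ → Fin m) => average V Φ η s.1 s.2 t := by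
  simp only [average_eq he hη]
  refine ⟨Finset.measurable_sum _ fun k _ => (h.measurable_iterate k).const_smul _,
    ∑ k ∈ Finset.Icc 1 t, (t : ℝ)⁻¹ * Real.sqrt (t * (e ^ 2 * (a₀ * κ) ^ 2 + 2 * e * V₀)),
    fun s => (norm_sum_le _ _).trans (Finset.sum_le_sum fun k hk => ?_)⟩
  rw [norm_smul, Real.norm_eq_abs, abs_of_nonneg (by positivity)]
  rw [Finset.mem_Icc] at hk
  gcongr
  exact h.norm_iterate_le he.le hη s.1 s.2 hk.1 (by omega)

/-- Jensen reduces the average to the iterates, which share the radius valid at time `t`; no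
logarithm arises. -/
theorem integral_risk_average_le (h : LearningSetting Y V Φ κ a₀ V₀) {e : ℝ} (he : 0 < e)
    (hη : ∀ t, 1 ≤ t → η t = e) {t : ℕ} (ht : 1 ≤ t) :
    ∫ s, risk ρ V Φ (average V Φ η s.1 s.2 t) ∂(sampleLaw ρ m) ≤
      infRisk ρ V Φ + approxError ρ V Φ (1 / (e * t)) +
        e * (a₀ * κ) ^ 2 / 2 +
        2 * (a₀ * κ * Real.sqrt (t * (e ^ 2 * (a₀ * κ) ^ 2 + 2 * e * V₀))) / Real.sqrt m := by
  have ht0 : (0 : ℝ) < t := by exact_mod_cast ht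
  set γ := 2 * (a₀ * κ * Real.sqrt (t * (e ^ 2 * (a₀ * κ) ^ 2 + 2 * e * V₀))) / Real.sqrt m
  have hi : ∀ k ∈ Finset.Icc 1 t, Integrable (fun s : (Fin m → X × Y) × (ℕ → Fin m) =>
      (t : ℝ)⁻¹ * risk ρ V Φ (iterate V Φ η s.1 s.2 k)) (sampleLaw ρ m) := fun k hk =>
    (h.integrable_risk ρ
      (h.boundedMeasurable_iterate he.le hη (Finset.mem_Icc.1 hk).1)).const_mul _
  have h1 : ∫ s, risk ρ V Φ (average V Φ η s.1 s.2 t) ∂(sampleLaw ρ m) ≤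
      ∫ s, ∑ k ∈ Finset.Icc 1 t, (t : ℝ)⁻¹ * risk ρ V Φ (iterate V Φ η s.1 s.2 k)
        ∂(sampleLaw ρ m) := by
    refine integral_mono (h.integrable_risk ρ (h.boundedMeasurable_average he hη t))
      (integrable_finsetSum _ hi) fun s => ?_
    simp only [average_eq he hη]
    refine (h.convexOn_risk ρ).map_sum_le (fun k _ => by positivity) ?_ fun k _ => trivial
    simp [ht0.ne']
  rw [integral_finsetSum _ hi] at h1
  have h2 : ∑ k ∈ Finset.Icc 1 t, ∫ s : (Fin m → X × Y) × (ℕ → Fin m),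
      (t : ℝ)⁻¹ * risk ρ V Φ (iterate V Φ η s.1 s.2 k) ∂(sampleLaw ρ m) ≤
      ∑ k ∈ Finset.Icc 1 t, (t : ℝ)⁻¹ *
        ((∫ s, empRisk V Φ s.1 (iterate V Φ η s.1 s.2 k) ∂(sampleLaw ρ m)) + γ) := by
    refine Finset.sum_le_sum fun k hk => ?_
    rw [Finset.mem_Icc] at hk
    rw [integral_const_mul]
    gcongr
    exact h.integral_risk_le (m := m) ρ (Real.sqrt_nonneg _) (h.measurable_iterate k)
      fun s => h.norm_iterate_le he.le hη s.1 s.2 (t := t) hk.1 (by omega)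
  have h3 := h.average_integral_empRisk_le (m := m) ρ he hη ht
  rw [← Finset.mul_sum, Finset.sum_add_distrib] at h2
  simp only [Finset.sum_const, Nat.card_Icc, add_tsub_cancel_right, nsmul_eq_mul] at h2
  rw [mul_add, inv_mul_cancel_left₀ ht0.ne', inv_mul_eq_div] at h2
  linarith

end LearningSetting

/-! ### Exponents for the chosen step size -/

section Rates

/-- The factor `√(e / m)` of the generalization term. -/
theorem rpow_step_sqrt {m : ℝ} (hm : 0 < m) {β : ℝ} (hβ : 0 < β) :
    Real.sqrt (m ^ (-(2 * β / (2 * β + 1)))) / Real.sqrt m =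
      m ^ (-((4 * β + 1) / (4 * β + 2))) := by
  rw [Real.sqrt_eq_rpow, Real.sqrt_eq_rpow, ← Real.rpow_mul hm.le, ← Real.rpow_sub hm]
  congr 1
  have h1 : 2 * β + 1 ≠ 0 := by positivity
  have h2 : 4 * β + 2 ≠ 0 := by positivity
  field_simp
  ring

/-- The approximation rate at the parameter `1 / (e * t)`. -/
theorem rpow_step_inv {m t : ℝ} (hm : 0 < m) (ht : 0 < t) (β : ℝ) :
    (1 / (m ^ (-(2 * β / (2 * β + 1))) * t)) ^ β = m ^ (2 * β ^ 2 / (2 * β + 1)) * t ^ (-β) := by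
  have h0 : 0 < m ^ (-(2 * β / (2 * β + 1))) := Real.rpow_pos_of_pos hm _
  rw [one_div, Real.inv_rpow (by positivity), Real.mul_rpow h0.le ht.le, mul_inv,
    ← Real.rpow_neg ht.le, ← Real.rpow_mul hm.le, ← Real.rpow_neg hm.le]
  congr 2
  ring

end Rates

end SGM

/-! ### Assembling the constants and the one-pass rate -/

theorem corollary7 (κ a₀ V₀ c : ℝ) :
    ∃ C : ℝ, 0 < C ∧
      ∀ (X : Type u) [MeasurableSpace X] (Y : Set ℝ)
        (F : Type v) [NormedAddCommGroup F] [InnerProductSpace ℝ F] [CompleteSpace F]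
        [TopologicalSpace.SeparableSpace F] [MeasurableSpace F] [BorelSpace F]
        (ρ : Measure (X × Y)) [IsProbabilityMeasure ρ]
        (V : ℝ → ℝ → ℝ) (Φ : X → F) (β : ℝ),
        Measurable (Function.uncurry V) → (∀ y a : ℝ, 0 ≤ V y a) → Measurable Φ →
        SGM.BoundednessAssumption Y V Φ κ a₀ V₀ →
        SGM.ApproxErrorAssumption ρ V Φ β c →
        ∀ m : ℕ, 1 ≤ m → ∀ η : ℕ → ℝ,
          (∀ t : ℕ, 1 ≤ t → η t = (m : ℝ) ^ (-(2 * β / (2 * β + 1)))) →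
          ∀ g : ℕ → (Fin m → X × Y) → (ℕ → Fin m) → F,
            (g = (fun t z j => SGM.average V Φ η z j t) ∨
              g = (fun t z j => SGM.iterate V Φ η z j t)) →
            (∀ t : ℕ, 1 ≤ t →
              Integrable (SGM.excessRisk ρ V Φ (g t)) (SGM.sampleLaw ρ m) ∧
              ∫ s, SGM.excessRisk ρ V Φ (g t) s ∂(SGM.sampleLaw ρ m) ≤
                C * ((m : ℝ) ^ (-((4 * β + 1) / (4 * β + 2))) * Real.sqrt t * Real.log t
                  + (m : ℝ) ^ (-(2 * β / (2 * β + 1))) * Real.log t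
                  + (m : ℝ) ^ (2 * β ^ 2 / (2 * β + 1)) * (t : ℝ) ^ (-β))) ∧
            (2 ≤ m →
              ∫ s, SGM.excessRisk ρ V Φ (g m) s ∂(SGM.sampleLaw ρ m) ≤
                C * ((m : ℝ) ^ (-(β / (2 * β + 1))) * Real.log m)) := by
  -- One summand per need: positivity, approximation, the case `t = 1`, optimization,
  -- generalization. Absolute values appear because the signs of the parameters are not yet known.
  set C₁ : ℝ := 1 + |c| + |V₀| + 5 / 2 * (a₀ * κ) ^ 2 +
    4 * (|a₀ * κ| * Real.sqrt ((a₀ * κ) ^ 2 + 2 * |V₀|)) with hC₁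
  have hC₁pos : 0 < C₁ := by positivity
  -- The factor `4` serves only the one-pass bound, where three terms merge into one.
  refine ⟨4 * C₁, by positivity, ?_⟩
  intro X _ Y F _ _ _ _ _ _ ρ _ V Φ β hV hV0 hΦ hB hA m hm η hη g hg
  have : SecondCountableTopology F := UniformSpace.secondCountable_of_separable F
  have : NeZero m := ⟨by omega⟩
  have h : SGM.LearningSetting Y V Φ κ a₀ V₀ := ⟨hB, hV, hV0, hΦ⟩
  obtain ⟨p₀⟩ := nonempty_of_isProbabilityMeasure ρ
  have ha := h.slope_bound_nonneg p₀
  have hκ := h.feature_bound_nonneg p₀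
  have hV₀ := h.loss_zero_bound_nonneg p₀
  have hβ := hA.beta_pos
  have hc := hA.c_pos
  have hG : 0 ≤ a₀ * κ := mul_nonneg ha hκ
  rw [abs_of_pos hc, abs_of_nonneg hV₀, abs_of_nonneg hG] at hC₁
  have hK0 : 0 ≤ a₀ * κ * Real.sqrt ((a₀ * κ) ^ 2 + 2 * V₀) := by positivity
  have hG2 : 0 ≤ (a₀ * κ) ^ 2 := sq_nonneg _
  have hC1 : 1 ≤ C₁ := by linarith
  have hCc : c ≤ C₁ := by linarith
  have hCV : V₀ ≤ C₁ := by linarith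
  have hCG : 5 / 2 * (a₀ * κ) ^ 2 ≤ C₁ := by linarith
  have hCK : 4 * (a₀ * κ * Real.sqrt ((a₀ * κ) ^ 2 + 2 * V₀)) ≤ C₁ := by linarith
  clear_value C₁
  clear hC₁
  have hm1 : (1 : ℝ) ≤ m := by exact_mod_cast hm
  have hm0 : (0 : ℝ) < m := by linarith
  set e : ℝ := (m : ℝ) ^ (-(2 * β / (2 * β + 1))) with he_def
  have he : 0 < e := Real.rpow_pos_of_pos hm0 _
  have he1 : e ≤ 1 := Real.rpow_le_one_of_one_le_of_nonpos hm1 (by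
    have : 0 ≤ 2 * β / (2 * β + 1) := by positivity
    linarith)
  set q : ℝ := (m : ℝ) ^ (-((4 * β + 1) / (4 * β + 2))) with hq_def
  have hq : 0 < q := Real.rpow_pos_of_pos hm0 _
  have hqe : Real.sqrt e / Real.sqrt m = q := SGM.rpow_step_sqrt hm0 hβ
  have hbm : ∀ t, 1 ≤ t → SGM.BoundedMeasurable
      fun s : (Fin m → X × Y) × (ℕ → Fin m) => g t s.1 s.2 := fun t ht => by
    rcases hg with rfl | rfl
    · exact h.boundedMeasurable_average he hη t
    · exact h.boundedMeasurable_iterate he.le hη ht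
  have hrate : ∀ t : ℕ, 1 ≤ t →
      Integrable (SGM.excessRisk ρ V Φ (g t)) (SGM.sampleLaw ρ m) ∧
      ∫ s, SGM.excessRisk ρ V Φ (g t) s ∂(SGM.sampleLaw ρ m) ≤
        C₁ * (q * Real.sqrt t * Real.log t + e * Real.log t
          + (m : ℝ) ^ (2 * β ^ 2 / (2 * β + 1)) * (t : ℝ) ^ (-β)) := by
    intro t ht
    have hint := h.integrable_risk (P := SGM.sampleLaw ρ m) ρ (hbm t ht)
    refine ⟨hint.sub (integrable_const _), ?_⟩
    have ht0 : (0 : ℝ) < t := by exact_mod_cast ht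
    have hex : ∫ s, SGM.excessRisk ρ V Φ (g t) s ∂(SGM.sampleLaw ρ m) =
        (∫ s, SGM.risk ρ V Φ (g t s.1 s.2) ∂(SGM.sampleLaw ρ m)) - SGM.infRisk ρ V Φ := by
      simp only [SGM.excessRisk]
      rw [integral_sub hint (integrable_const _), integral_const, probReal_univ, one_smul]
    rw [hex]
    -- At `t = 1` the logarithms vanish, but the output is `0`, of risk at most `V₀`, and the last
    -- term is at least `C₁`. For `t ≥ 2`, `1 ≤ 2 * log t` absorbs the additive constants.
    rcases Nat.eq_or_lt_of_le ht with rfl | ht2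
    · have hg1 : ∀ s : (Fin m → X × Y) × (ℕ → Fin m), g 1 s.1 s.2 = 0 := fun s => by
        rcases hg with rfl | rfl <;> simp [SGM.average, SGM.iterate]
      simp only [hg1, integral_const, probReal_univ, one_smul, Nat.cast_one, Real.log_one,
        mul_zero, Real.one_rpow, mul_one, zero_add]
      have h1 := h.risk_le ρ (w := 0) (R := 0) (by simp)
      have h2 := h.infRisk_nonneg ρ
      have h3 : (1 : ℝ) ≤ (m : ℝ) ^ (2 * β ^ 2 / (2 * β + 1)) :=
        Real.one_le_rpow hm1 (by positivity)
      have h4 := mul_le_mul_of_nonneg_left h3 hC₁pos.le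
      linarith
    · have hL : 1 ≤ 2 * Real.log t := by
        have h1 : Real.log 2 ≤ Real.log t :=
          Real.log_le_log (by norm_num) (by exact_mod_cast ht2)
        have := Real.log_two_gt_d9
        linarith
      have hbound : ∫ s, SGM.risk ρ V Φ (g t s.1 s.2) ∂(SGM.sampleLaw ρ m) ≤
          SGM.infRisk ρ V Φ + SGM.approxError ρ V Φ (1 / (e * t)) +
            e * (a₀ * κ) ^ 2 / 2 * (2 + Real.log t) +
            2 * (a₀ * κ * Real.sqrt (t * (e ^ 2 * (a₀ * κ) ^ 2 + 2 * e * V₀))) / Real.sqrt m := by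
        rcases hg with rfl | rfl
        · refine (h.integral_risk_average_le (m := m) ρ he hη ht).trans ?_
          have : 0 ≤ e * (a₀ * κ) ^ 2 / 2 := by positivity
          have : e * (a₀ * κ) ^ 2 / 2 * 1 ≤ e * (a₀ * κ) ^ 2 / 2 * (2 + Real.log t) := by
            gcongr
            linarith
          linarith
        · exact h.integral_risk_iterate_le (m := m) ρ he hη ht
      have hD := hA.decay (1 / (e * t)) (by positivity)
      rw [SGM.rpow_step_inv hm0 ht0 β] at hD
      set D := (m : ℝ) ^ (2 * β ^ 2 / (2 * β + 1)) * (t : ℝ) ^ (-β) with hDdef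
      have hD0 : 0 ≤ D := by positivity
      set K := Real.sqrt ((a₀ * κ) ^ 2 + 2 * V₀) with hK
      -- As `e ≤ 1`, both contributions to the squared radius are of order `e * t`.
      have hsqrt : Real.sqrt (t * (e ^ 2 * (a₀ * κ) ^ 2 + 2 * e * V₀)) ≤
          Real.sqrt e * Real.sqrt t * K := by
        rw [hK, ← Real.sqrt_mul he.le, ← Real.sqrt_mul (by positivity)]
        refine Real.sqrt_le_sqrt ?_
        have h1 : e ^ 2 * (a₀ * κ) ^ 2 ≤ e * (a₀ * κ) ^ 2 := by
          gcongr
          exact pow_le_of_le_one he.le he1 two_ne_zero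
        have h2 : e * t * ((a₀ * κ) ^ 2 + 2 * V₀) =
            t * (e * (a₀ * κ) ^ 2 + 2 * e * V₀) := by ring
        rw [h2]
        gcongr
      have hgen : 2 * (a₀ * κ * Real.sqrt (t * (e ^ 2 * (a₀ * κ) ^ 2 + 2 * e * V₀))) /
          Real.sqrt m ≤ 2 * (a₀ * κ * K) * (q * Real.sqrt t) := by
        have e1 : 2 * (a₀ * κ * K) * (q * Real.sqrt t) =
            2 * (a₀ * κ * (Real.sqrt e * Real.sqrt t * K)) / Real.sqrt m := by
          rw [← hqe]
          ring
        rw [e1]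
        gcongr
      have hqt : 0 ≤ q * Real.sqrt t := by positivity
      have f1 : c * D ≤ C₁ * D := by gcongr
      have f2 : e * (a₀ * κ) ^ 2 / 2 * (2 + Real.log t) ≤ C₁ * (e * Real.log t) := by
        have g1 : e * (a₀ * κ) ^ 2 / 2 * (2 + Real.log t) ≤
            e * (a₀ * κ) ^ 2 / 2 * (5 * Real.log t) := by
          gcongr
          linarith
        have g2 : 5 / 2 * (a₀ * κ) ^ 2 * (e * Real.log t) ≤ C₁ * (e * Real.log t) := by
          have : 0 ≤ Real.log t := by linarith
          gcongr
        linarith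
      have f3 : 2 * (a₀ * κ * K) * (q * Real.sqrt t) ≤ C₁ * (q * Real.sqrt t * Real.log t) := by
        have g1 : 2 * (a₀ * κ * K) * (q * Real.sqrt t) * 1 ≤
            2 * (a₀ * κ * K) * (q * Real.sqrt t) * (2 * Real.log t) := by
          gcongr
        have g2 : 4 * (a₀ * κ * K) * (q * Real.sqrt t * Real.log t) ≤
            C₁ * (q * Real.sqrt t * Real.log t) := by
          have : 0 ≤ Real.log t := by linarith
          gcongr
        linarith
      linarith
  refine ⟨fun t ht => ⟨(hrate t ht).1, (hrate t ht).2.trans ?_⟩, fun hm2 => ?_⟩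
  · have ht1 : (1 : ℝ) ≤ t := by exact_mod_cast ht
    have := Real.log_nonneg ht1
    gcongr
    linarith
  · refine (hrate m hm).2.trans ?_
    -- At `t = m` the first and third powers both equal `r`, and `e ≤ r`. The sum is at most `r *
    -- log m + r * log m + r`, and `r ≤ 2 * r * log m` since `m ≥ 2`.
    set r : ℝ := (m : ℝ) ^ (-(β / (2 * β + 1))) with hr
    have hr0 : 0 < r := Real.rpow_pos_of_pos hm0 _
    have hb1 : 2 * β + 1 ≠ 0 := by positivity
    have e1 : q * Real.sqrt m = r := by
      rw [hq_def, Real.sqrt_eq_rpow, ← Real.rpow_add hm0, hr]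
      congr 1
      have : 4 * β + 2 ≠ 0 := by positivity
      field_simp
      ring
    have e2 : (m : ℝ) ^ (2 * β ^ 2 / (2 * β + 1)) * (m : ℝ) ^ (-β) = r := by
      rw [← Real.rpow_add hm0, hr]
      congr 1
      field_simp
      ring
    have e3 : e ≤ r := by
      refine Real.rpow_le_rpow_of_exponent_le hm1 (neg_le_neg ?_)
      gcongr
      linarith
    rw [e1, e2]
    have hL : 1 ≤ 2 * Real.log m := by
      have h1 : Real.log 2 ≤ Real.log m :=
        Real.log_le_log (by norm_num) (by exact_mod_cast hm2)
      have := Real.log_two_gt_d9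
      linarith
    have e4 : e * Real.log m ≤ r * Real.log m := by
      gcongr
    have e5 : r * 1 ≤ r * (2 * Real.log m) := by gcongr
    rw [mul_comm 4 C₁, mul_assoc]
    gcongr
    linarith
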